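/- Let $c\in\{1,-1\}$, let $\langle x,y\rangle=-x_1y_1+c\,x_2y_2+x_3y_3+x_4y_4$ on $\mathbb R^4$, and let $\mathbb M^3_c=\{x\in\mathbb R^4:\langle x,x\rangle=c\}$; thus $\mathbb M^3_1$ is the De Sitter space $\mathbb S^3_1\subset\mathbb R^4_1$ and $\mathbb M^3_{-1}$ is the anti De Sitter space $\mathbb H^3_1\subset\mathbb R^4_2$. Let $M$ be a connected surface and let $\psi:M\to\mathbb M^3_c\subset\mathbb R^4$ be a smooth immersion whose induced metric is nondegenerate (Riemannian or Lorentzian), oriented by a smooth unit vector field $N$ normal to $M$ in $\mathbb M^3_c$, with $\langle N,N\rangle=\varepsilon=\pm1$. Let $\nabla^0$ be the flat connection of $\mathbb R^4$, $\nabla$ the Levi-Civita connection of $M$, $S X=-\nabla^0_XN$ the shape operator, $H=\frac{\varepsilon}{2}\operatorname{tr}S$ the mean curvature, $H_2=\det S$ the second mean curvature, and $P_1=-2\varepsilon H I+S$ the Newton transformation. For a smooth function $f$ on $M$ put $L_1f=\operatorname{tr}(P_1\circ\nabla^2f)$, where $\nabla^2f(X)=\nabla_X(\nabla f)$; let $L_1$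 act coordinatewise on $\mathbb R^4$-valued functions. Suppose that $M$ is of $L_1$-$2$-type, that is, $\psi=a+\psi_1+\psi_2$ for a constant vector $a\in\mathbb R^4$ and non-constant smooth functions $\psi_1,\psi_2:M\to\mathbb R^4$ with $L_1\psi_1=\lambda_1\psi_1$, $L_1\psi_2=\lambda_2\psi_2$, where $\lambda_1\ne\lambda_2$ are real numbers. Then the following conditions are equivalent to each other: 1) $M$ has a constant principal curvature, that is, there is a real number $\kappa$ that is an eigenvalue of $S$ at every point of $M$; 2) $H$ is constant; 3) $H_2$ is constant. -/

import Mathlib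

open scoped Manifold ContDiff

noncomputable section

/-- The indefinite scalar product `-x₀y₀ + c x₁y₁ + x₂y₂ + x₃y₃` on `ℝ⁴`; it has index `1` for
`c = 1` and index `2` for `c = -1`. -/
def pseudoInner (c : ℝ) : LinearMap.BilinForm ℝ (EuclideanSpace ℝ (Fin 4)) :=
  LinearMap.mk₂ ℝ (fun x y => -(x 0 * y 0) + c * (x 1 * y 1) + x 2 * y 2 + x 3 * y 3)
    (fun x x' y => by simp only [PiLp.add_apply]; ring)
    (fun a x y => by simp only [PiLp.smul_apply, smul_eq_mul]; ring)
    (fun x y y' => by simp only [PiLp.add_apply]; ring)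
    (fun a x y => by simp only [PiLp.smul_apply, smul_eq_mul]; ring)

lemma pseudoInner_apply (c : ℝ) (x y : EuclideanSpace ℝ (Fin 4)) :
    pseudoInner c x y = -(x 0 * y 0) + c * (x 1 * y 1) + x 2 * y 2 + x 3 * y 3 := rfl

/-- The Lorentzian space form: the De Sitter space `S³₁ ⊂ ℝ⁴₁` for `c = 1` and the anti De Sitter
space `H³₁ ⊂ ℝ⁴₂` for `c = -1`. -/
def lorentzSpaceForm (c : ℝ) : Set (EuclideanSpace ℝ (Fin 4)) :=
  {x | pseudoInner c x x = c}

/-- The pull-back of the ambient scalar product by a map `ψ : M → ℝ⁴`. -/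
def inducedMetric (c : ℝ) {M : Type*} [TopologicalSpace M]
    [ChartedSpace (EuclideanSpace ℝ (Fin 2)) M] (ψ : M → EuclideanSpace ℝ (Fin 4)) (p : M) :
    LinearMap.BilinForm ℝ (TangentSpace (𝓡 2) p) :=
  (pseudoInner c).compl₁₂ (mvfderiv (𝓡 2) ψ p).toLinearMap (mvfderiv (𝓡 2) ψ p).toLinearMap

/-- A smooth surface immersed in the Lorentzian space form, with nondegenerate induced metric
(which forces `dψ` to be injective), oriented by a globally defined smooth unit normal field `N`
of causal character `ε = ⟨N, N⟩ = ±1`. -/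
structure OrientedSurface (c : ℝ) (M : Type*) [TopologicalSpace M]
    [ChartedSpace (EuclideanSpace ℝ (Fin 2)) M] where
  ψ : M → EuclideanSpace ℝ (Fin 4)
  N : M → EuclideanSpace ℝ (Fin 4)
  ε : ℝ
  contMDiff_ψ : ContMDiff (𝓡 2) 𝓘(ℝ, EuclideanSpace ℝ (Fin 4)) ∞ ψ
  contMDiff_N : ContMDiff (𝓡 2) 𝓘(ℝ, EuclideanSpace ℝ (Fin 4)) ∞ N
  ψ_mem : ∀ p, ψ p ∈ lorentzSpaceForm c
  nondegenerate : ∀ p, (inducedMetric c ψ p).Nondegenerate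
  ε_eq : ε = 1 ∨ ε = -1
  N_unit : ∀ p, pseudoInner c (N p) (N p) = ε
  N_tangent_spaceForm : ∀ p, pseudoInner c (N p) (ψ p) = 0
  N_normal : ∀ p (v : TangentSpace (𝓡 2) p), pseudoInner c (N p) (mvfderiv (𝓡 2) ψ p v) = 0

namespace OrientedSurface

variable {c : ℝ} {M : Type*} [TopologicalSpace M] [ChartedSpace (EuclideanSpace ℝ (Fin 2)) M]

instance finiteDimensional_tangentSpace (p : M) :
    FiniteDimensional ℝ (TangentSpace (𝓡 2) p) :=
  inferInstanceAs (FiniteDimensional ℝ (EuclideanSpace ℝ (Fin 2)))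

/-- The induced metric of the surface. -/
def metric (S : OrientedSurface c M) (p : M) : LinearMap.BilinForm ℝ (TangentSpace (𝓡 2) p) :=
  inducedMetric c S.ψ p

/-- The tangent vector representing a linear form through the induced metric. -/
def sharp (S : OrientedSurface c M) (p : M) :
    Module.Dual ℝ (TangentSpace (𝓡 2) p) ≃ₗ[ℝ] TangentSpace (𝓡 2) p :=
  ((S.metric p).toDual (S.nondegenerate p)).symm

/-- The tangential component of an ambient vector at the point `p` of the surface: the tangent
vector `u` with `⟨dψ u, dψ w⟩ = ⟨x, dψ w⟩` for every tangent vector `w`. -/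
def tangential (S : OrientedSurface c M) (p : M) :
    EuclideanSpace ℝ (Fin 4) →ₗ[ℝ] TangentSpace (𝓡 2) p :=
  (S.sharp p).toLinearMap ∘ₗ
    ((pseudoInner c).compl₁₂ LinearMap.id (mvfderiv (𝓡 2) S.ψ p).toLinearMap)

lemma metric_apply (S : OrientedSurface c M) (p : M) (u w : TangentSpace (𝓡 2) p) :
    S.metric p u w =
      pseudoInner c (mvfderiv (𝓡 2) S.ψ p u) (mvfderiv (𝓡 2) S.ψ p w) := rfl

lemma metric_sharp (S : OrientedSurface c M) (p : M) (f : Module.Dual ℝ (TangentSpace (𝓡 2) p))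
    (w : TangentSpace (𝓡 2) p) : S.metric p (S.sharp p f) w = f w :=
  LinearMap.BilinForm.apply_toDual_symm_apply ..

lemma metric_tangential (S : OrientedSurface c M) (p : M) (x : EuclideanSpace ℝ (Fin 4))
    (w : TangentSpace (𝓡 2) p) :
    S.metric p (S.tangential p x) w = pseudoInner c x (mvfderiv (𝓡 2) S.ψ p w) :=
  S.metric_sharp ..

lemma metric_ext (S : OrientedSurface c M) (p : M) {u v : TangentSpace (𝓡 2) p}
    (h : ∀ w, S.metric p u w = S.metric p v w) : u = v :=
  ((S.metric p).toDual (S.nondegenerate p)).injective (LinearMap.ext h)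

lemma tangential_mvfderiv (S : OrientedSurface c M) (p : M) (v : TangentSpace (𝓡 2) p) :
    S.tangential p (mvfderiv (𝓡 2) S.ψ p v) = v :=
  S.metric_ext p fun w => by rw [metric_tangential, metric_apply]

/-- In the preferred chart at `p`, the derivative at `p` is the usual derivative. -/
lemma mvfderiv_eq_fderiv {F : Type*} [NormedAddCommGroup F] [NormedSpace ℝ F] {f : M → F} {p : M}
    (hf : MDifferentiableAt (𝓡 2) 𝓘(ℝ, F) f p) :
    DifferentiableAt ℝ (f ∘ (extChartAt (𝓡 2) p).symm) (extChartAt (𝓡 2) p p) ∧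
      ∀ v : EuclideanSpace ℝ (Fin 2), mvfderiv (𝓡 2) f p v =
        fderiv ℝ (f ∘ (extChartAt (𝓡 2) p).symm) (extChartAt (𝓡 2) p p) v := by
  have h1 := hf.differentiableWithinAt_writtenInExtChartAt
  have h2 := hf.mvfderiv
  have h3 : writtenInExtChartAt (𝓡 2) 𝓘(ℝ, F) p f = f ∘ (extChartAt (𝓡 2) p).symm := by
    simp only [writtenInExtChartAt, extChartAt_model_space_eq_id]; rfl
  rw [h3] at h1 h2
  simp only [ModelWithCorners.range_eq_univ, differentiableWithinAt_univ,
    fderivWithin_univ] at h1 h2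
  exact ⟨h1, fun v => congrArg (fun L => L v) h2⟩

/-- If the vector field `Y` on the surface is differentiable at `p`, so is the `ℝ⁴`-valued
function `dψ(Y)`. -/
lemma mdifferentiableAt_mvfderiv_apply [IsManifold (𝓡 2) ∞ M] (S : OrientedSurface c M)
    {Y : (q : M) → TangentSpace (𝓡 2) q} {p : M}
    (hY : MDifferentiableAt (𝓡 2) (𝓡 2).tangent (fun q => (⟨q, Y q⟩ : TangentBundle (𝓡 2) M)) p) :
    MDifferentiableAt (𝓡 2) 𝓘(ℝ, EuclideanSpace ℝ (Fin 4))
      (fun q => mvfderiv (𝓡 2) S.ψ q (Y q)) p := by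
  have h1 : ContMDiff (𝓡 2).tangent 𝓘(ℝ, EuclideanSpace ℝ (Fin 4)).tangent 1
      (tangentMap (𝓡 2) 𝓘(ℝ, EuclideanSpace ℝ (Fin 4)) S.ψ) :=
    S.contMDiff_ψ.contMDiff_tangentMap (by norm_cast)
  have h2 := (contMDiff_snd_tangentBundle_modelSpace (EuclideanSpace ℝ (Fin 4))
    𝓘(ℝ, EuclideanSpace ℝ (Fin 4)) (n := 1)).comp h1
  exact ((h2 _).mdifferentiableAt one_ne_zero).comp p hY

/-- The Levi-Civita connection of the induced metric: `∇_X Y` is the tangential component of the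
derivative of `dψ(Y)` in the direction `X`. The two lemmas below show that it is compatible with
the metric and torsion-free. -/
def leviCivita [IsManifold (𝓡 2) ∞ M] (S : OrientedSurface c M) :
    CovariantDerivative (𝓡 2) (EuclideanSpace ℝ (Fin 2))
      (TangentSpace (𝓡 2) : M → Type _) where
  toFun Y p := (LinearMap.toContinuousLinearMap (S.tangential p)).comp
    (mvfderiv (𝓡 2) (fun q => mvfderiv (𝓡 2) S.ψ q (Y q)) p)
  isCovariantDerivativeOnUniv :=
    { add := by
        intro Y Z p hY hZ _
        have h : (fun q => mvfderiv (𝓡 2) S.ψ q ((Y + Z) q)) =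
            (fun q => mvfderiv (𝓡 2) S.ψ q (Y q)) + fun q => mvfderiv (𝓡 2) S.ψ q (Z q) := by
          ext1 q
          exact map_add (mvfderiv (𝓡 2) S.ψ q) (Y q) (Z q)
        rw [h, mvfderiv_add (S.mdifferentiableAt_mvfderiv_apply hY)
          (S.mdifferentiableAt_mvfderiv_apply hZ), ContinuousLinearMap.comp_add]
      leibniz := by
        intro Y f p hY hf _
        have h : (fun q => mvfderiv (𝓡 2) S.ψ q ((f • Y) q)) =
            f • fun q => mvfderiv (𝓡 2) S.ψ q (Y q) := by
          ext1 q
          exact map_smul (mvfderiv (𝓡 2) S.ψ q) (f q) (Y q)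
        rw [h, mvfderiv_smul hf (S.mdifferentiableAt_mvfderiv_apply hY)]
        refine ContinuousLinearMap.ext fun v => ?_
        simp [tangential_mvfderiv] }

lemma leviCivita_apply [IsManifold (𝓡 2) ∞ M] (S : OrientedSurface c M)
    (Y : (q : M) → TangentSpace (𝓡 2) q) (p : M) (v : TangentSpace (𝓡 2) p) :
    S.leviCivita Y p v =
      S.tangential p (mvfderiv (𝓡 2) (fun q => mvfderiv (𝓡 2) S.ψ q (Y q)) p v) := rfl

/-- The connection is compatible with the metric: `v⟨Y, Z⟩ = ⟨∇_v Y, Z⟩ + ⟨Y, ∇_v Z⟩`. -/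
lemma leviCivita_metric [IsManifold (𝓡 2) ∞ M] (S : OrientedSurface c M)
    {Y Z : (q : M) → TangentSpace (𝓡 2) q} {p : M}
    (hY : MDifferentiableAt (𝓡 2) (𝓡 2).tangent (fun q => (⟨q, Y q⟩ : TangentBundle (𝓡 2) M)) p)
    (hZ : MDifferentiableAt (𝓡 2) (𝓡 2).tangent (fun q => (⟨q, Z q⟩ : TangentBundle (𝓡 2) M)) p)
    (v : TangentSpace (𝓡 2) p) :
    mvfderiv (𝓡 2) (fun q => S.metric q (Y q) (Z q)) p v =
      S.metric p (S.leviCivita Y p v) (Z p) + S.metric p (Y p) (S.leviCivita Z p v) := by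
  have hA := S.mdifferentiableAt_mvfderiv_apply hY
  have hB := S.mdifferentiableAt_mvfderiv_apply hZ
  obtain ⟨dA, eA⟩ := mvfderiv_eq_fderiv hA
  obtain ⟨dB, eB⟩ := mvfderiv_eq_fderiv hB
  have hm : MDifferentiableAt (𝓡 2) 𝓘(ℝ, ℝ) (fun q => S.metric q (Y q) (Z q)) p :=
    (((pseudoInner c).toContinuousBilinearMap.contMDiff (n := 1)).mdifferentiableAt
      one_ne_zero).comp p hA |>.clm_apply hB
  have key := (pseudoInner c).toContinuousBilinearMap.fderiv_of_bilinear dA dB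
  have hsymm : ∀ x y, pseudoInner c x y = pseudoInner c y x := fun x y => by
    simp only [pseudoInner_apply]; ring
  rw [metric_apply _ _ (Y p), hsymm, ← metric_apply, leviCivita_apply, leviCivita_apply,
    metric_tangential, metric_tangential]
  have hA0 : ((fun q => mvfderiv (𝓡 2) S.ψ q (Y q)) ∘ (extChartAt (𝓡 2) p).symm)
      (extChartAt (𝓡 2) p p) = mvfderiv (𝓡 2) S.ψ p (Y p) :=
    congrArg (fun q => mvfderiv (𝓡 2) S.ψ q (Y q)) (extChartAt_to_inv (I := 𝓡 2) p)
  have hB0 : ((fun q => mvfderiv (𝓡 2) S.ψ q (Z q)) ∘ (extChartAt (𝓡 2) p).symm)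
      (extChartAt (𝓡 2) p p) = mvfderiv (𝓡 2) S.ψ p (Z p) :=
    congrArg (fun q => mvfderiv (𝓡 2) S.ψ q (Z q)) (extChartAt_to_inv (I := 𝓡 2) p)
  rw [hA0, hB0] at key
  refine ((mvfderiv_eq_fderiv hm).2 v).trans ((congrArg (fun L => L v) key).trans ?_)
  rw [hsymm _ (mvfderiv (𝓡 2) S.ψ p (Y p)), eA v, eB v]
  exact add_comm (G := ℝ) _ _

/-- The connection is torsion-free: `∇_X Y - ∇_Y X = [X, Y]`. -/
lemma leviCivita_torsion [IsManifold (𝓡 2) ∞ M] (S : OrientedSurface c M)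
    {X Y : (q : M) → TangentSpace (𝓡 2) q} {p : M}
    (hX : MDifferentiableAt (𝓡 2) (𝓡 2).tangent (fun q => (⟨q, X q⟩ : TangentBundle (𝓡 2) M)) p)
    (hY : MDifferentiableAt (𝓡 2) (𝓡 2).tangent (fun q => (⟨q, Y q⟩ : TangentBundle (𝓡 2) M)) p) :
    S.leviCivita Y p (X p) - S.leviCivita X p (Y p) =
      VectorField.mlieBracket (𝓡 2) X Y p := by
  have : IsManifold (𝓡 2) 2 M := .of_le (n := ∞) (by norm_cast)
  have : IsManifold (𝓡 2) 1 M := .of_le (n := ∞) (by norm_cast)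
  set φ := extChartAt (𝓡 2) p with hφ
  set pb : ((q : M) → TangentSpace (𝓡 2) q) → EuclideanSpace ℝ (Fin 2) →
      EuclideanSpace ℝ (Fin 2) := fun Z => VectorField.mpullbackWithin
    𝓘(ℝ, EuclideanSpace ℝ (Fin 2)) (𝓡 2) φ.symm Z (Set.range (𝓡 2)) with hpb
  set F : EuclideanSpace ℝ (Fin 2) → EuclideanSpace ℝ (Fin 4) := S.ψ ∘ φ.symm with hF
  have hd : ∀ {Z : (q : M) → TangentSpace (𝓡 2) q},
      MDifferentiableAt (𝓡 2) (𝓡 2).tangent (fun q => (⟨q, Z q⟩ : TangentBundle (𝓡 2) M)) p →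
      DifferentiableAt ℝ (pb Z) (φ p) := by
    intro Z hZ
    have h := MDifferentiableWithinAt.differentiableWithinAt_mpullbackWithin_vectorField
      (hZ.mdifferentiableWithinAt (s := Set.univ))
    rw [Set.preimage_univ, Set.univ_inter] at h
    refine DifferentiableWithinAt.differentiableAt h ?_
    rw [ModelWithCorners.range_eq_univ]
    exact Filter.univ_mem
  have hself : ∀ Z : (q : M) → TangentSpace (𝓡 2) q, pb Z (φ p) = Z p := by
    intro Z
    change (mfderivWithin 𝓘(ℝ, EuclideanSpace ℝ (Fin 2)) (𝓡 2) φ.symm (Set.range (𝓡 2))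
      (φ p)).inverse (Z (φ.symm (φ p))) = Z p
    refine (mfderivWithin_extChartAt_symm_inverse_apply (I := 𝓡 2) (x := p)
      (Z (φ.symm (φ p)))).trans ?_
    exact congr_heq (f := Z) (g := Z) (by rfl) (by simp [hφ])
  have hFd : ContDiffAt ℝ 2 F (φ p) := by
    have h := ((S.contMDiff_ψ.of_le (m := 2) (by norm_cast)) p)
    rw [contMDiffAt_iff] at h
    have h' := h.2
    rw [ModelWithCorners.range_eq_univ, contDiffWithinAt_univ, extChartAt_model_space_eq_id] at h'
    exact h'
  have hev : ∀ Z : (q : M) → TangentSpace (𝓡 2) q,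
      ((fun q => mvfderiv (𝓡 2) S.ψ q (Z q)) ∘ φ.symm) =ᶠ[nhds (φ p)] fun z =>
        fderiv ℝ F z (pb Z z) := by
    intro Z
    filter_upwards [extChartAt_target_mem_nhds (I := 𝓡 2) p] with z hz
    have h1 := isInvertible_mfderivWithin_extChartAt_symm (I := 𝓡 2) hz
    have h2 : MDifferentiableAt 𝓘(ℝ, EuclideanSpace ℝ (Fin 2)) (𝓡 2) φ.symm z := by
      have := mdifferentiableWithinAt_extChartAt_symm (I := 𝓡 2) hz
      rwa [ModelWithCorners.range_eq_univ, mdifferentiableWithinAt_univ] at this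
    have h3 : MDifferentiableAt (𝓡 2) 𝓘(ℝ, EuclideanSpace ℝ (Fin 4)) S.ψ (φ.symm z) :=
      (S.contMDiff_ψ _).mdifferentiableAt (by simp)
    have h4 := mfderiv_comp z h3 h2
    rw [mfderiv_eq_fderiv] at h4
    rw [ModelWithCorners.range_eq_univ, mfderivWithin_univ] at h1
    have h5 : pb Z z = (mfderiv 𝓘(ℝ, EuclideanSpace ℝ (Fin 2)) (𝓡 2) φ.symm z).inverse
        (Z (φ.symm z)) := by
      rw [← mfderivWithin_univ, ← ModelWithCorners.range_eq_univ (𝓡 2)]; rfl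
    rw [h5]
    refine (DFunLike.congr_fun h4 ((mfderiv 𝓘(ℝ, EuclideanSpace ℝ (Fin 2)) (𝓡 2) φ.symm z).inverse
      (Z (φ.symm z)))).trans ?_ |>.symm
    exact congrArg (mfderiv (𝓡 2) 𝓘(ℝ, EuclideanSpace ℝ (Fin 4)) S.ψ (φ.symm z))
      (h1.self_apply_inverse _)
  have hbr : VectorField.mlieBracket (𝓡 2) X Y p =
      VectorField.lieBracket ℝ (pb X) (pb Y) (φ p) := by
    rw [← VectorField.mlieBracketWithin_univ, VectorField.mlieBracketWithin_apply,
      mfderiv_extChartAt_self]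
    have hs : φ.symm ⁻¹' Set.univ ∩ Set.range (𝓡 2) = Set.univ := by
      rw [ModelWithCorners.range_eq_univ, Set.preimage_univ, Set.univ_inter]
    have h : VectorField.lieBracketWithin ℝ (pb X) (pb Y)
        (φ.symm ⁻¹' Set.univ ∩ Set.range (𝓡 2)) (φ p) =
        VectorField.lieBracket ℝ (pb X) (pb Y) (φ p) := by
      rw [hs, VectorField.lieBracketWithin_univ]
    refine Eq.trans ?_ h
    exact DFunLike.congr_fun (ContinuousLinearMap.inverse_id (R := ℝ)
      (M := EuclideanSpace ℝ (Fin 2))) _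
  have hder : ∀ {Z : (q : M) → TangentSpace (𝓡 2) q}
      (hZ : MDifferentiableAt (𝓡 2) (𝓡 2).tangent
        (fun q => (⟨q, Z q⟩ : TangentBundle (𝓡 2) M)) p) (v : EuclideanSpace ℝ (Fin 2)),
      mvfderiv (𝓡 2) (fun q => mvfderiv (𝓡 2) S.ψ q (Z q)) p v =
        fderiv ℝ (fderiv ℝ F) (φ p) v (Z p) + fderiv ℝ F (φ p) (fderiv ℝ (pb Z) (φ p) v) := by
    intro Z hZ v
    refine ((mvfderiv_eq_fderiv (S.mdifferentiableAt_mvfderiv_apply hZ)).2 v).trans ?_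
    rw [(hev Z).fderiv_eq, fderiv_clm_apply
      ((hFd.fderiv_right (m := 1) (by norm_num)).differentiableAt one_ne_zero) (hd hZ), hself]
    exact add_comm (G := EuclideanSpace ℝ (Fin 4)) _ _
  have hF1 : ∀ v : EuclideanSpace ℝ (Fin 2), mvfderiv (𝓡 2) S.ψ p v = fderiv ℝ F (φ p) v :=
    (mvfderiv_eq_fderiv ((S.contMDiff_ψ p).mdifferentiableAt (by simp))).2
  rw [leviCivita_apply, leviCivita_apply, ← map_sub]
  refine Eq.trans ?_ (S.tangential_mvfderiv p _)
  congr 1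
  refine (congrArg₂ (· - ·) (hder hY (X p)) (hder hX (Y p))).trans ?_
  rw [hbr]
  refine Eq.trans ?_ (hF1 _).symm
  rw [VectorField.lieBracket, map_sub, hself, hself,
    (hFd.isSymmSndFDerivAt (by simp)).eq (X p) (Y p)]
  abel

/-- The shape operator `v ↦ -∇⁰_v N`, where `∇⁰` is the flat connection of `ℝ⁴`. The vector
`∇⁰_v N` is tangent to the surface, and `tangential` gives the tangent vector that it is. -/
def shape (S : OrientedSurface c M) (p : M) : Module.End ℝ (TangentSpace (𝓡 2) p) :=
  -(S.tangential p ∘ₗ (mvfderiv (𝓡 2) S.N p).toLinearMap)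

/-- The mean curvature `H = (ε/2) tr S`. -/
def meanCurvature (S : OrientedSurface c M) (p : M) : ℝ :=
  S.ε / 2 * LinearMap.trace ℝ _ (S.shape p)

/-- The second mean curvature `H₂ = det S`. -/
def secondMeanCurvature (S : OrientedSurface c M) (p : M) : ℝ :=
  LinearMap.det (S.shape p)

/-- The Newton transformation `P₁ = -2εH I + S`. -/
def newton (S : OrientedSurface c M) (p : M) : Module.End ℝ (TangentSpace (𝓡 2) p) :=
  -(2 * S.ε * S.meanCurvature p) • LinearMap.id + S.shape p

/-- The gradient of a function with respect to the induced metric. -/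
def gradient (S : OrientedSurface c M) (f : M → ℝ) (p : M) : TangentSpace (𝓡 2) p :=
  S.sharp p (mvfderiv (𝓡 2) f p).toLinearMap

/-- The Hessian operator `v ↦ ∇_v (∇f)`. -/
def hessian [IsManifold (𝓡 2) ∞ M] (S : OrientedSurface c M) (f : M → ℝ) (p : M) :
    Module.End ℝ (TangentSpace (𝓡 2) p) :=
  (S.leviCivita (S.gradient f) p).toLinearMap

/-- The Cheng-Yau operator `L₁ f = tr (P₁ ∘ ∇²f)`. -/
def L₁ [IsManifold (𝓡 2) ∞ M] (S : OrientedSurface c M) (f : M → ℝ) (p : M) : ℝ :=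
  LinearMap.trace ℝ _ (S.newton p ∘ₗ S.hessian f p)

/-- The operator `L₁` on `ℝ⁴`-valued functions, acting on each coordinate. -/
def L₁vec [IsManifold (𝓡 2) ∞ M] (S : OrientedSurface c M) (F : M → EuclideanSpace ℝ (Fin 4))
    (p : M) : EuclideanSpace ℝ (Fin 4) :=
  WithLp.toLp 2 fun i => S.L₁ (fun q => F q i) p

/-- The surface is of `L₁`-2-type: `ψ = a + ψ₁ + ψ₂` with a constant vector `a` and smooth
non-constant eigenfunctions `ψ₁, ψ₂` of `L₁` with distinct real eigenvalues. -/
def IsL₁TwoType [IsManifold (𝓡 2) ∞ M] (S : OrientedSurface c M) : Prop :=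
  ∃ (a : EuclideanSpace ℝ (Fin 4)) (ψ₁ ψ₂ : M → EuclideanSpace ℝ (Fin 4)) (lam₁ lam₂ : ℝ),
    ContMDiff (𝓡 2) 𝓘(ℝ, EuclideanSpace ℝ (Fin 4)) ∞ ψ₁ ∧
    ContMDiff (𝓡 2) 𝓘(ℝ, EuclideanSpace ℝ (Fin 4)) ∞ ψ₂ ∧
    (¬ ∃ b, ∀ p, ψ₁ p = b) ∧ (¬ ∃ b, ∀ p, ψ₂ p = b) ∧
    lam₁ ≠ lam₂ ∧
    (∀ p, S.ψ p = a + ψ₁ p + ψ₂ p) ∧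
    (∀ p, S.L₁vec ψ₁ p = lam₁ • ψ₁ p) ∧ (∀ p, S.L₁vec ψ₂ p = lam₂ • ψ₂ p)

/-- Some real constant is a principal curvature, that is, an eigenvalue of the shape operator, at
every point. -/
def HasConstantPrincipalCurvature (S : OrientedSurface c M) : Prop :=
  ∃ κ : ℝ, ∀ p, Module.End.HasEigenvalue (S.shape p) κ

/-- The mean curvature is constant. -/
def HasConstantMeanCurvature (S : OrientedSurface c M) : Prop :=
  ∃ h : ℝ, ∀ p, S.meanCurvature p = h

/-- The second mean curvature is constant. -/
def HasConstantSecondMeanCurvature (S : OrientedSurface c M) : Prop :=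
  ∃ h : ℝ, ∀ p, S.secondMeanCurvature p = h

end OrientedSurface

end

/-! Fix a vector a, put f = ⟨a,ψ⟩, n = ⟨a,N⟩, and l = λ₁λ₂. The structure equations give ∇²f = εnS −
cfI and ∇n = −S∇f. By Codazzi, P₁ is divergence-free, so L₁u = div(P₁∇u); by Cayley–Hamilton, P₁S =
−H₂I. Hence L₁ψ = −2εH₂N + 2cεHψ (`L₁_height`), and L₁N is computed likewise (`L₁_angle`).

The 2-type condition gives (L₁ − λ₁)(L₁ − λ₂)(ψ − a) = 0. Its components along TM, N and ψ are three
scalar relations (`IsL₁TwoType.equations`): E1 expresses l df through dH₂ and dH∘P₁, while E2 and E3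
express ln and lf through H, H₂, L₁H₂ and L₁H. In each of the implications 2 → 3, 3 → 2 and 1 → 2
they force the curvature function in question to be a root of one of finitely many nonzero
polynomials wherever its differential is nonzero. A continuous function cannot vary inside a finite
set, so it is constant (`eq_of_mem_finite`).

2 → 3: E1 and the derivative of E3 give H₂ dH₂ = 0. 3 → 2: E1 on S v and the derivative of E2 give
H₂(H₂ + 2cε) dH = 0. If that coefficient vanishes, the divergence of E1 makes lf quadratic in H, so
dH is an eigenform of P₁ with eigenvalue affine in H, and the characteristic equation is quadratic
in H. 1 → 2: H₂ is affine in H, and E2 + 2κE3 is free of L₁H. Its derivative and E1 give dH∘(αS + β)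
= 0, so det(αS + β) = 0 wherever dH ≠ 0.

2 → 1: H₂ is constant too. If H₂ ≤ H², the characteristic polynomial has a constant real root.
Otherwise S has no real eigenvalue; then ∇S = 0 (`nablaShape_eq_zero`) and the surface is flat, εH₂
+ c = 0 (`secondMeanCurvature_eq_of_lt`). E2 and E3 then give λ₁ + λ₂ = 0 and λ₁λ₂ = 4 − 4H² > 0,
which is absurd for real λ's.

Tangent fields and tensors are represented throughout by maps into ℝ⁴ or End ℝ⁴, extended by zero on
the normal space, so that only derivatives of vector-valued maps occur. -/

noncomputable section

local notation "𝔼²" => EuclideanSpace ℝ (Fin 2)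
local notation "𝔼⁴" => EuclideanSpace ℝ (Fin 4)
local notation "𝐝" => mvfderiv (𝓡 2)

/-- The scalar product of `ℝ⁴` as a continuous bilinear map. -/
def pseudoInnerL (c : ℝ) : 𝔼⁴ →L[ℝ] 𝔼⁴ →L[ℝ] ℝ := (pseudoInner c).toContinuousBilinearMap

@[simp] lemma pseudoInnerL_apply (c : ℝ) (x y : 𝔼⁴) : pseudoInnerL c x y = pseudoInner c x y := rfl

lemma pseudoInner_comm (c : ℝ) (x y : 𝔼⁴) : pseudoInner c x y = pseudoInner c y x := by
  simp only [pseudoInner_apply]; ring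

/-! ### Calculus of vector-valued maps on the surface, in charts. -/

namespace OrientedSurface

variable {c : ℝ} {M : Type*} [TopologicalSpace M] [ChartedSpace (EuclideanSpace ℝ (Fin 2)) M]
  {W X Y : Type*} [NormedAddCommGroup W] [NormedSpace ℝ W]
  [NormedAddCommGroup X] [NormedSpace ℝ X] [NormedAddCommGroup Y] [NormedSpace ℝ Y]

/-- Smooth maps from the surface to a normed space. -/
abbrev IsSmooth (f : M → W) : Prop := ContMDiff (𝓡 2) 𝓘(ℝ, W) ∞ f

/-- Maps from the surface to a normed space that are differentiable at a point. -/
abbrev IsDiffAt (f : M → W) (p : M) : Prop := MDifferentiableAt (𝓡 2) 𝓘(ℝ, W) f p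

lemma IsSmooth.isDiffAt {f : M → W} (hf : IsSmooth f) (p : M) : IsDiffAt f p :=
  (hf p).mdifferentiableAt (by simp)

lemma hasDeriv_bilin (b : W →L[ℝ] X →L[ℝ] Y) {f : M → W} {g : M → X} {p : M}
    (hf : IsDiffAt f p) (hg : IsDiffAt g p) :
    IsDiffAt (fun q => b (f q) (g q)) p ∧ ∀ v : TangentSpace (𝓡 2) p,
      𝐝 (fun q => b (f q) (g q)) p v = b (𝐝 f p v) (g p) + b (f p) (𝐝 g p v) := by
  have hm : IsDiffAt (fun q => b (f q) (g q)) p :=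
    ((b.contMDiff (n := 1)).mdifferentiableAt one_ne_zero).comp p hf |>.clm_apply hg
  refine ⟨hm, fun v => ?_⟩
  obtain ⟨dA, eA⟩ := mvfderiv_eq_fderiv hf
  obtain ⟨dB, eB⟩ := mvfderiv_eq_fderiv hg
  have key := b.fderiv_of_bilinear dA dB
  have hA0 : (f ∘ (extChartAt (𝓡 2) p).symm) (extChartAt (𝓡 2) p p) = f p :=
    congrArg f (extChartAt_to_inv (I := 𝓡 2) p)
  have hB0 : (g ∘ (extChartAt (𝓡 2) p).symm) (extChartAt (𝓡 2) p p) = g p :=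
    congrArg g (extChartAt_to_inv (I := 𝓡 2) p)
  rw [hA0, hB0] at key
  refine ((mvfderiv_eq_fderiv hm).2 v).trans ((congrArg (fun L => L v) key).trans ?_)
  rw [eA v, eB v]
  exact add_comm (G := Y) _ _

lemma hasDeriv_clm (l : W →L[ℝ] X) {f : M → W} {p : M} (hf : IsDiffAt f p) :
    IsDiffAt (fun q => l (f q)) p ∧ ∀ v : TangentSpace (𝓡 2) p,
      𝐝 (fun q => l (f q)) p v = l (𝐝 f p v) := by
  have hm : IsDiffAt (fun q => l (f q)) p :=
    ((l.contMDiff (n := 1)).mdifferentiableAt one_ne_zero).comp p hf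
  refine ⟨hm, fun v => ?_⟩
  obtain ⟨dA, eA⟩ := mvfderiv_eq_fderiv hf
  refine ((mvfderiv_eq_fderiv hm).2 v).trans ?_
  rw [eA v]
  exact congrArg (fun L => L v) ((l.hasFDerivAt.comp _ dA.hasFDerivAt).fderiv)

lemma IsSmooth.clm (l : W →L[ℝ] X) {f : M → W} (hf : IsSmooth f) : IsSmooth fun q => l (f q) :=
  l.contMDiff.comp hf

lemma IsSmooth.bilin (b : W →L[ℝ] X →L[ℝ] Y) {f : M → W} {g : M → X}
    (hf : IsSmooth f) (hg : IsSmooth g) : IsSmooth fun q => b (f q) (g q) :=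
  (b.contMDiff.comp hf).clm_apply hg

lemma IsSmooth.contDiffAt_chart {f : M → W} (hf : IsSmooth f) (p : M) :
    ContDiffAt ℝ ∞ (f ∘ (extChartAt (𝓡 2) p).symm) (extChartAt (𝓡 2) p p) := by
  have h := hf p
  rw [contMDiffAt_iff] at h
  have h' := h.2
  rw [ModelWithCorners.range_eq_univ, contDiffWithinAt_univ, extChartAt_model_space_eq_id] at h'
  exact h'

section Chart

variable [IsManifold (𝓡 2) ∞ M]

/-- The inverse of the preferred chart at `p` has invertible differential. -/
lemma exists_chart_equiv (p : M) {z : 𝔼²} (hz : z ∈ (extChartAt (𝓡 2) p).target) :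
    ∃ A : 𝔼² ≃L[ℝ] TangentSpace (𝓡 2) ((extChartAt (𝓡 2) p).symm z),
      (A : 𝔼² →L[ℝ] TangentSpace (𝓡 2) ((extChartAt (𝓡 2) p).symm z)) =
        mfderiv 𝓘(ℝ, 𝔼²) (𝓡 2) (extChartAt (𝓡 2) p).symm z := by
  have : IsManifold (𝓡 2) 1 M := .of_le (n := ∞) (by norm_cast)
  have h1 := isInvertible_mfderivWithin_extChartAt_symm (I := 𝓡 2) hz
  rwa [ModelWithCorners.range_eq_univ, mfderivWithin_univ] at h1

lemma mdifferentiableAt_chart_symm (p : M) {z : 𝔼²} (hz : z ∈ (extChartAt (𝓡 2) p).target) :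
    MDifferentiableAt 𝓘(ℝ, 𝔼²) (𝓡 2) (extChartAt (𝓡 2) p).symm z := by
  have : IsManifold (𝓡 2) 1 M := .of_le (n := ∞) (by norm_cast)
  have := mdifferentiableWithinAt_extChartAt_symm (I := 𝓡 2) hz
  rwa [ModelWithCorners.range_eq_univ, mdifferentiableWithinAt_univ] at this

/-- On the domain of the preferred chart at `p`, the derivative in the chart is the composition of
the differential on the surface with that of the inverse of the chart. -/
lemma fderiv_comp_chart (p : M) {z : 𝔼²} (hz : z ∈ (extChartAt (𝓡 2) p).target)
    {A : 𝔼² ≃L[ℝ] TangentSpace (𝓡 2) ((extChartAt (𝓡 2) p).symm z)}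
    (hA : (A : 𝔼² →L[ℝ] TangentSpace (𝓡 2) ((extChartAt (𝓡 2) p).symm z)) =
      mfderiv 𝓘(ℝ, 𝔼²) (𝓡 2) (extChartAt (𝓡 2) p).symm z) {f : M → W}
    (hf : IsDiffAt f ((extChartAt (𝓡 2) p).symm z)) (v : 𝔼²) :
    fderiv ℝ (f ∘ (extChartAt (𝓡 2) p).symm) z v =
      𝐝 f ((extChartAt (𝓡 2) p).symm z) (A v) := by
  have h4 := mfderiv_comp z hf (mdifferentiableAt_chart_symm p hz)
  rw [mfderiv_eq_fderiv, ← hA] at h4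
  exact DFunLike.congr_fun h4 v

end Chart

/-! ### Tangential extension of differentials, gradients, symmetry of Hessians. -/

/-- The differential of `K`, extended by zero to the ambient normal space of the surface. -/
def along (S : OrientedSurface c M) (K : M → W) (q : M) : 𝔼⁴ →L[ℝ] W :=
  (𝐝 K q).comp (LinearMap.toContinuousLinearMap (S.tangential q))

lemma along_apply (S : OrientedSurface c M) (K : M → W) (q : M) (y : 𝔼⁴) :
    S.along K q y = 𝐝 K q (S.tangential q y) := rfl

lemma along_mvfderiv (S : OrientedSurface c M) (K : M → W) (q : M) (v : TangentSpace (𝓡 2) q) :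
    S.along K q (𝐝 S.ψ q v) = 𝐝 K q v := by
  rw [along_apply, tangential_mvfderiv]

set_option maxHeartbeats 1000000 in
-- In a chart the tangential part of y is I⁻¹(J y), with I the first fundamental form and J y = ⟨y,
-- ∂F⟩. Both are smooth, and inversion is smooth at the invertible map I.
lemma contMDiff_along [IsManifold (𝓡 2) ∞ M] (S : OrientedSurface c M) {K : M → W}
    (hK : IsSmooth K) : IsSmooth (S.along K) := by
  intro p
  set φ := extChartAt (𝓡 2) p with hφ
  set F : 𝔼² → 𝔼⁴ := S.ψ ∘ φ.symm with hF
  set G : 𝔼² → W := K ∘ φ.symm with hG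
  let k : (𝔼² →L[ℝ] 𝔼⁴) →L[ℝ] (𝔼⁴ →L[ℝ] ℝ) →L[ℝ] 𝔼² →L[ℝ] ℝ :=
    (ContinuousLinearMap.compL ℝ 𝔼² 𝔼⁴ ℝ).flip
  let J : 𝔼² → 𝔼⁴ →L[ℝ] 𝔼² →L[ℝ] ℝ := fun z => (k (fderiv ℝ F z)).comp (pseudoInnerL c)
  have hJ : ∀ z y w, J z y w = pseudoInner c y (fderiv ℝ F z w) := fun z y w => rfl
  let I : 𝔼² → 𝔼² →L[ℝ] 𝔼² →L[ℝ] ℝ := fun z => (J z).comp (fderiv ℝ F z)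
  have hI : ∀ z v w, I z v w = pseudoInner c (fderiv ℝ F z v) (fderiv ℝ F z w) :=
    fun z v w => rfl
  have hF0 : ContDiffAt ℝ ∞ F (φ p) := IsSmooth.contDiffAt_chart S.contMDiff_ψ p
  have hF1 : ContDiffAt ℝ ∞ (fderiv ℝ F) (φ p) := hF0.fderiv_right (by simp)
  have hG1 : ContDiffAt ℝ ∞ (fderiv ℝ G) (φ p) :=
    (IsSmooth.contDiffAt_chart hK p).fderiv_right (by simp)
  have hk : ContDiffAt ℝ ∞ (fun z => k (fderiv ℝ F z)) (φ p) := by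
    fun_prop
  have hJs : ContDiffAt ℝ ∞ J (φ p) := hk.clm_comp contDiffAt_const
  have hIs : ContDiffAt ℝ ∞ I (φ p) := hJs.clm_comp hF1
  have key : ∀ z ∈ φ.target, (I z).IsInvertible ∧
      S.along K (φ.symm z) = (fderiv ℝ G z).comp ((I z).inverse.comp (J z)) := by
    intro z hz
    obtain ⟨A, hA⟩ := exists_chart_equiv p hz
    have hFA : ∀ v, fderiv ℝ F z v = 𝐝 S.ψ (φ.symm z) (A v) :=
      fderiv_comp_chart p hz hA (IsSmooth.isDiffAt S.contMDiff_ψ _)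
    have hGA : ∀ v, fderiv ℝ G z v = 𝐝 K (φ.symm z) (A v) :=
      fderiv_comp_chart p hz hA (IsSmooth.isDiffAt hK _)
    have hinj : Function.Injective (I z).toLinearMap := by
      rw [← LinearMap.ker_eq_bot, LinearMap.ker_eq_bot']
      intro v hv
      have : A v = 0 := by
        refine S.metric_ext _ fun w => ?_
        have := DFunLike.congr_fun hv (A.symm w)
        change I z v (A.symm w) = 0 at this
        rw [hI, hFA, hFA, A.apply_symm_apply] at this
        rw [metric_apply, this, map_zero]; rfl
      exact A.injective (this.trans (map_zero A).symm)
    have hinv : (I z).IsInvertible := by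
      let e := LinearEquiv.ofInjectiveOfFinrankEq (I z).toLinearMap hinj
        (InnerProductSpace.toDual ℝ 𝔼²).toLinearEquiv.finrank_eq
      exact ⟨e.toContinuousLinearEquiv, by ext; rfl⟩
    refine ⟨hinv, ?_⟩
    ext y
    have : (I z).inverse (J z y) = A.symm (S.tangential (φ.symm z) y) := by
      have h : J z y = I z (A.symm (S.tangential (φ.symm z) y)) := by
        ext1 w
        rw [hJ, hI, hFA, hFA, A.apply_symm_apply, ← metric_apply, metric_tangential]
      rw [h]
      exact hinv.inverse_apply_self _
    rw [along_apply, ContinuousLinearMap.comp_apply, ContinuousLinearMap.comp_apply, this, hGA,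
      A.apply_symm_apply]
  have hloc : ContDiffAt ℝ ∞ (fun z => (fderiv ℝ G z).comp ((I z).inverse.comp (J z))) (φ p) :=
    hG1.clm_comp (((key _ (mem_extChartAt_target p)).1.contDiffAt_map_inverse.comp _ hIs).clm_comp
      hJs)
  have := hloc.contMDiffAt.comp p (contMDiffAt_extChartAt (I := 𝓡 2) (n := ∞))
  refine this.congr_of_eventuallyEq ?_
  filter_upwards [extChartAt_source_mem_nhds (I := 𝓡 2) p] with q hq
  have h := (key (φ q) (φ.map_source hq)).2
  rw [φ.left_inv hq] at h
  exact h

/-- The gradient of a function as a vector of `ℝ⁴`. -/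
def gradVec (S : OrientedSurface c M) (f : M → ℝ) (q : M) : 𝔼⁴ := 𝐝 S.ψ q (S.gradient f q)

lemma metric_gradient (S : OrientedSurface c M) (f : M → ℝ) (q : M) (w : TangentSpace (𝓡 2) q) :
    S.metric q (S.gradient f q) w = 𝐝 f q w := S.metric_sharp ..

lemma metric_comm (S : OrientedSurface c M) (q : M) (v w : TangentSpace (𝓡 2) q) :
    S.metric q v w = S.metric q w v := by
  rw [metric_apply, pseudoInner_comm, ← metric_apply]

lemma pseudoInner_gradVec (S : OrientedSurface c M) (f : M → ℝ) (q : M) (y : 𝔼⁴) :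
    pseudoInner c (S.gradVec f q) y = S.along f q y := by
  rw [pseudoInner_comm, gradVec, ← metric_tangential, metric_comm, metric_gradient, along_apply]

/-- A vector is recovered from its products with the standard basis; the coefficients −1, c, 1, 1
invert the Gram matrix, since c⁻¹ = c. This makes the gradient a fixed linear image of the smooth
map `along f`. -/
lemma gradVec_eq_sum (hc : c * c = 1) (S : OrientedSurface c M) (f : M → ℝ) (q : M) :
    S.gradVec f q = ∑ i : Fin 4, (![-1, c, 1, 1] i * S.along f q (EuclideanSpace.single i 1)) •
      EuclideanSpace.single i (1 : ℝ) := by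
  simp only [← pseudoInner_gradVec]
  ext j
  fin_cases j <;> simp [Fin.sum_univ_four, pseudoInner_apply, ← mul_assoc, hc]

lemma contMDiff_gradVec [IsManifold (𝓡 2) ∞ M] (hc : c * c = 1) (S : OrientedSurface c M)
    {f : M → ℝ} (hf : IsSmooth f) : IsSmooth (S.gradVec f) := by
  have : S.gradVec f = fun q => (∑ i : Fin 4, (ContinuousLinearMap.apply ℝ ℝ
      (![-1, c, 1, 1] i • EuclideanSpace.single i (1 : ℝ) : 𝔼⁴)).smulRight
        (EuclideanSpace.single i (1 : ℝ) : 𝔼⁴)) (S.along f q) := by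
    ext1 q
    rw [gradVec_eq_sum hc, sum_apply]
    refine Finset.sum_congr rfl fun i _ => ?_
    simp
  rw [this]
  exact IsSmooth.clm _ (S.contMDiff_along hf)

/-- The Hessian of a smooth function is symmetric. -/
lemma hessian_symm [IsManifold (𝓡 2) ∞ M] (hc : c * c = 1) (S : OrientedSurface c M)
    {f : M → ℝ} (hf : IsSmooth f) (p : M) (v w : TangentSpace (𝓡 2) p) :
    pseudoInner c (𝐝 (S.gradVec f) p v) (𝐝 S.ψ p w) =
      pseudoInner c (𝐝 (S.gradVec f) p w) (𝐝 S.ψ p v) := by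
  set φ := extChartAt (𝓡 2) p with hφ
  set F : 𝔼² → 𝔼⁴ := S.ψ ∘ φ.symm with hF
  set g : 𝔼² → ℝ := f ∘ φ.symm with hg
  have hV := (IsSmooth.isDiffAt (S.contMDiff_gradVec hc hf) p)
  obtain ⟨dV, eV⟩ := mvfderiv_eq_fderiv hV
  rw [← hφ] at dV eV
  set Vz : 𝔼² → 𝔼⁴ := S.gradVec f ∘ φ.symm with hVz
  have eF := (mvfderiv_eq_fderiv (IsSmooth.isDiffAt S.contMDiff_ψ p)).2
  have hF0 : ContDiffAt ℝ ∞ F (φ p) := IsSmooth.contDiffAt_chart S.contMDiff_ψ p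
  have hg0 : ContDiffAt ℝ ∞ g (φ p) := IsSmooth.contDiffAt_chart hf p
  have hF1 : DifferentiableAt ℝ (fderiv ℝ F) (φ p) :=
    (hF0.fderiv_right (m := 1) (by norm_cast)).differentiableAt one_ne_zero
  have hg1 : DifferentiableAt ℝ (fderiv ℝ g) (φ p) :=
    (hg0.fderiv_right (m := 1) (by norm_cast)).differentiableAt one_ne_zero
  -- The relation ⟨∇f, ∂ᵤF⟩ = ∂ᵤg determines the gradient. Differentiating it writes the Hessian as
  -- D²g − ⟨∇f, D²F⟩, which is symmetric.
  have hev : ∀ u : 𝔼², (fun z => pseudoInnerL c (Vz z) (fderiv ℝ F z u)) =ᶠ[nhds (φ p)]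
      fun z => fderiv ℝ g z u := by
    intro u
    filter_upwards [extChartAt_target_mem_nhds (I := 𝓡 2) p] with z hz
    obtain ⟨A, hA⟩ := exists_chart_equiv p hz
    have h1 := fderiv_comp_chart p hz hA (IsSmooth.isDiffAt S.contMDiff_ψ _) u
    have h2 := fderiv_comp_chart p hz hA (IsSmooth.isDiffAt hf _) u
    rw [pseudoInnerL_apply]
    refine (congrArg _ h1).trans (Eq.trans ?_ h2.symm)
    exact (S.pseudoInner_gradVec f _ _).trans (S.along_mvfderiv f _ _)
  have hder : ∀ u t : 𝔼², pseudoInner c (fderiv ℝ Vz (φ p) t) (fderiv ℝ F (φ p) u) =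
      fderiv ℝ (fderiv ℝ g) (φ p) t u -
        pseudoInner c (Vz (φ p)) (fderiv ℝ (fderiv ℝ F) (φ p) t u) := by
    intro u t
    have h1 := (hev u).fderiv_eq (𝕜 := ℝ)
    have h2 : fderiv ℝ (fun z => fderiv ℝ g z u) (φ p) t = fderiv ℝ (fderiv ℝ g) (φ p) t u := by
      rw [fderiv_clm_apply hg1 (differentiableAt_const u)]; simp
    have h3 : fderiv ℝ (fun z => fderiv ℝ F z u) (φ p) t = fderiv ℝ (fderiv ℝ F) (φ p) t u := by
      rw [fderiv_clm_apply hF1 (differentiableAt_const u)]; simp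
    have h4 := (pseudoInnerL c).fderiv_of_bilinear dV
      (hF1.clm_apply (differentiableAt_const u))
    have h5 := DFunLike.congr_fun (h4.symm.trans h1) t
    change pseudoInner c (Vz (φ p)) (fderiv ℝ (fun z => fderiv ℝ F z u) (φ p) t) +
      pseudoInner c (fderiv ℝ Vz (φ p) t) (fderiv ℝ F (φ p) u) =
      fderiv ℝ (fun z => fderiv ℝ g z u) (φ p) t at h5
    rw [h2, h3] at h5
    linarith
  have hsF := (hF0.isSymmSndFDerivAt (by simp; norm_cast)).eq v w
  have hsg := (hg0.isSymmSndFDerivAt (by simp; norm_cast)).eq v w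
  have e1 := hder w v
  have e2 := hder v w
  rw [hsF, hsg] at e1
  rw [eV v, eV w]
  refine (congrArg _ (eF w)).trans (Eq.trans ?_ (congrArg _ (eF v)).symm)
  exact e1.trans e2.symm

/-! ### Criteria for a function on a connected surface to be constant. -/

lemma eq_of_mvfderiv_eq_zero [IsManifold (𝓡 2) ∞ M] [ConnectedSpace M] {f : M → ℝ}
    (hf : IsSmooth f) (h : ∀ p v, 𝐝 f p v = 0) : ∃ k, ∀ p, f p = k := by
  have hloc : IsLocallyConstant f := by
    rw [IsLocallyConstant.iff_eventually_eq]
    intro p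
    set φ := extChartAt (𝓡 2) p with hφ
    obtain ⟨r, hr, hball⟩ := Metric.mem_nhds_iff.1 (extChartAt_target_mem_nhds (I := 𝓡 2) p)
    have hc : ∀ z ∈ Metric.ball (φ p) r, (f ∘ φ.symm) z = (f ∘ φ.symm) (φ p) := by
      intro z hz
      refine (convex_ball (φ p) r).is_const_of_fderivWithin_eq_zero (𝕜 := ℝ)
        (f := f ∘ φ.symm) ?_ ?_ hz (Metric.mem_ball_self hr)
      · intro y hy
        have hy' := hball hy
        have hs := mdifferentiableAt_chart_symm p hy'
        exact (((hf.isDiffAt _).comp y hs).differentiableAt).differentiableWithinAt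
      · intro y hy
        rw [fderivWithin_of_isOpen Metric.isOpen_ball hy]
        obtain ⟨A, hA⟩ := exists_chart_equiv p (hball hy)
        have hz := hball hy
        ext1 v
        exact (fderiv_comp_chart p hz hA (IsSmooth.isDiffAt hf _) v).trans (h _ _)
    have hpre := (continuousAt_extChartAt (I := 𝓡 2) p).preimage_mem_nhds
      (Metric.ball_mem_nhds (φ p) hr)
    filter_upwards [hpre, extChartAt_source_mem_nhds (I := 𝓡 2) p] with q hq hqs
    have := hc _ hq
    simp only [Function.comp_apply] at this
    rwa [φ.left_inv hqs, extChartAt_to_inv] at this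
  obtain ⟨p₀⟩ := (inferInstance : Nonempty M)
  exact ⟨f p₀, fun p => hloc.apply_eq_of_isPreconnected isPreconnected_univ trivial trivial⟩

/-- If df ≠ 0 at p, then df ≠ 0 near p, so f takes values in Z near p; being continuous, f is
locally constant there, which contradicts df ≠ 0. -/
lemma eq_of_mem_finite [IsManifold (𝓡 2) ∞ M] [ConnectedSpace M] (S : OrientedSurface c M)
    {f : M → ℝ} (hf : IsSmooth f) {Z : Set ℝ} (hZ : Z.Finite)
    (h : ∀ p, (∃ v, 𝐝 f p v ≠ 0) → f p ∈ Z) : ∃ k, ∀ p, f p = k := by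
  refine eq_of_mvfderiv_eq_zero hf fun p v => ?_
  by_contra hv
  have hy : S.along f p (𝐝 S.ψ p v) ≠ 0 := by rwa [along_mvfderiv]
  have hcont : Continuous fun q => S.along f q (𝐝 S.ψ p v) :=
    (S.contMDiff_along hf).continuous.clm_apply continuous_const
  have hev : ∀ᶠ q in nhds p, f q ∈ Z :=
    (hcont.continuousAt.eventually_ne hy).mono fun q hq => h q ⟨_, hq⟩
  have hcl : ∀ᶠ t in nhds (f p), t ∉ Z \ {f p} :=
    (hZ.subset Set.sdiff_subset).isClosed.isOpen_compl.mem_nhds (by simp)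
  have hc2 : f =ᶠ[nhds p] fun _ => f p := by
    filter_upwards [hev, hf.continuous.continuousAt.eventually hcl] with q h1 h2
    by_contra h3
    exact h2 ⟨h1, h3⟩
  apply hv
  have := hc2.mfderiv_eq (I := 𝓡 2) (I' := 𝓘(ℝ, ℝ))
  have h0 : 𝐝 f p = 𝐝 (fun _ : M => f p) p := by
    ext u; exact DFunLike.congr_fun this u
  rw [h0, mvfderiv_const]; rfl

end OrientedSurface

/-! ### Endomorphisms of a plane: trace, determinant, Cayley–Hamilton. -/

section Planar

variable {V : Type*} [AddCommGroup V] [Module ℝ V] [FiniteDimensional ℝ V]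

lemma charpoly_of_finrank_two (hV : Module.finrank ℝ V = 2) (f : Module.End ℝ V) :
    f.charpoly = Polynomial.X ^ 2 - Polynomial.C (LinearMap.trace ℝ V f) * Polynomial.X +
      Polynomial.C (LinearMap.det f) := by
  let b := Module.finBasisOfFinrankEq ℝ V hV
  rw [← LinearMap.charpoly_toMatrix f b, Matrix.charpoly_fin_two,
    ← LinearMap.trace_eq_matrix_trace, LinearMap.det_toMatrix]

lemma cayley_hamilton_of_finrank_two (hV : Module.finrank ℝ V = 2) (f : Module.End ℝ V) (v : V) :
    f (f v) = LinearMap.trace ℝ V f • f v - LinearMap.det f • v := by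
  have h := LinearMap.aeval_self_charpoly f
  rw [charpoly_of_finrank_two hV] at h
  have := DFunLike.congr_fun h v
  simp [pow_two, Module.algebraMap_end_eq_smul_id] at this
  rw [← sub_eq_zero, ← this]; abel

lemma trace_comp_self_of_finrank_two (hV : Module.finrank ℝ V = 2) (f : Module.End ℝ V) :
    LinearMap.trace ℝ V (f ∘ₗ f) = LinearMap.trace ℝ V f ^ 2 - 2 * LinearMap.det f := by
  have : f ∘ₗ f = LinearMap.trace ℝ V f • f - LinearMap.det f • LinearMap.id := by
    ext v; exact cayley_hamilton_of_finrank_two hV f v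
  rw [this, map_sub, map_smul, map_smul, LinearMap.trace_id, hV]
  simp; ring

end Planar

/-! ### Product rules, the adapted frame and Weingarten's formula. -/

namespace OrientedSurface

variable {c : ℝ} {M : Type*} [TopologicalSpace M] [ChartedSpace (EuclideanSpace ℝ (Fin 2)) M]
  {W X Y : Type*} [NormedAddCommGroup W] [NormedSpace ℝ W]
  [NormedAddCommGroup X] [NormedSpace ℝ X] [NormedAddCommGroup Y] [NormedSpace ℝ Y]

lemma hasDeriv_mul {f g : M → ℝ} {p : M} (hf : IsDiffAt f p) (hg : IsDiffAt g p) :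
    IsDiffAt (fun q => f q * g q) p ∧ ∀ v : TangentSpace (𝓡 2) p,
      𝐝 (fun q => f q * g q) p v = 𝐝 f p v * g p + f p * 𝐝 g p v :=
  hasDeriv_bilin (ContinuousLinearMap.mul ℝ ℝ) hf hg

lemma hasDeriv_smul {f : M → ℝ} {g : M → W} {p : M} (hf : IsDiffAt f p) (hg : IsDiffAt g p) :
    IsDiffAt (fun q => f q • g q) p ∧ ∀ v : TangentSpace (𝓡 2) p,
      𝐝 (fun q => f q • g q) p v = 𝐝 f p v • g p + f p • 𝐝 g p v :=
  hasDeriv_bilin (ContinuousLinearMap.lsmul ℝ ℝ) hf hg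

lemma hasDeriv_apply {A : M → W →L[ℝ] X} {g : M → W} {p : M} (hA : IsDiffAt A p)
    (hg : IsDiffAt g p) :
    IsDiffAt (fun q => A q (g q)) p ∧ ∀ v : TangentSpace (𝓡 2) p,
      𝐝 (fun q => A q (g q)) p v = 𝐝 A p v (g p) + A p (𝐝 g p v) :=
  hasDeriv_bilin (ContinuousLinearMap.id ℝ (W →L[ℝ] X)) hA hg

lemma hasDeriv_inner {f g : M → 𝔼⁴} {p : M} (hf : IsDiffAt f p) (hg : IsDiffAt g p) :
    IsDiffAt (fun q => pseudoInner c (f q) (g q)) p ∧ ∀ v : TangentSpace (𝓡 2) p,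
      𝐝 (fun q => pseudoInner c (f q) (g q)) p v =
        pseudoInner c (𝐝 f p v) (g p) + pseudoInner c (f p) (𝐝 g p v) :=
  hasDeriv_bilin (pseudoInnerL c) hf hg

lemma hasDeriv_add {f g : M → W} {p : M} (hf : IsDiffAt f p) (hg : IsDiffAt g p) :
    IsDiffAt (fun q => f q + g q) p ∧ ∀ v : TangentSpace (𝓡 2) p,
      𝐝 (fun q => f q + g q) p v = 𝐝 f p v + 𝐝 g p v :=
  ⟨hf.add hg, fun v => DFunLike.congr_fun (mvfderiv_add hf hg) v⟩

lemma hasDeriv_sub {f g : M → W} {p : M} (hf : IsDiffAt f p) (hg : IsDiffAt g p) :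
    IsDiffAt (fun q => f q - g q) p ∧ ∀ v : TangentSpace (𝓡 2) p,
      𝐝 (fun q => f q - g q) p v = 𝐝 f p v - 𝐝 g p v :=
  ⟨hf.sub hg, fun v => DFunLike.congr_fun (mvfderiv_sub hf hg) v⟩

lemma hasDeriv_const (k : W) (p : M) :
    IsDiffAt (fun _ : M => k) p ∧ ∀ v : TangentSpace (𝓡 2) p, 𝐝 (fun _ : M => k) p v = 0 :=
  ⟨mdifferentiableAt_const, fun v => by rw [mvfderiv_const]; rfl⟩

lemma hasDeriv_const_smul (k : ℝ) {f : M → W} {p : M} (hf : IsDiffAt f p) :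
    IsDiffAt (fun q => k • f q) p ∧ ∀ v : TangentSpace (𝓡 2) p,
      𝐝 (fun q => k • f q) p v = k • 𝐝 f p v := by
  obtain ⟨h1, h2⟩ := hasDeriv_smul (hasDeriv_const k p).1 hf
  exact ⟨h1, fun v => by rw [h2, (hasDeriv_const k p).2]; simp⟩

lemma inner_deriv_eq_zero {f g : M → 𝔼⁴} {p : M} (hf : IsDiffAt f p) (hg : IsDiffAt g p) {k : ℝ}
    (h : ∀ q, pseudoInner c (f q) (g q) = k) (v : TangentSpace (𝓡 2) p) :
    pseudoInner c (𝐝 f p v) (g p) + pseudoInner c (f p) (𝐝 g p v) = 0 := by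
  rw [← (hasDeriv_inner hf hg).2]
  have : (fun q => pseudoInner c (f q) (g q)) = fun _ => k := funext h
  rw [this, (hasDeriv_const k p).2]

variable (S : OrientedSurface c M)

lemma smooth_ψ : IsSmooth S.ψ := S.contMDiff_ψ

lemma smooth_N : IsSmooth S.N := S.contMDiff_N

lemma diff_ψ (p : M) : IsDiffAt S.ψ p := S.smooth_ψ.isDiffAt p

lemma diff_N (p : M) : IsDiffAt S.N p := S.smooth_N.isDiffAt p

lemma ε_mul_self : S.ε * S.ε = 1 := by
  rcases S.ε_eq with h | h <;> rw [h] <;> norm_num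

lemma finrank_tangentSpace (p : M) : Module.finrank ℝ (TangentSpace (𝓡 2) p) = 2 :=
  finrank_euclideanSpace_fin (𝕜 := ℝ) (n := 2)

lemma inner_ψ_ψ (p : M) : pseudoInner c (S.ψ p) (S.ψ p) = c := S.ψ_mem p

lemma inner_ψ_N (p : M) : pseudoInner c (S.ψ p) (S.N p) = 0 := by
  rw [pseudoInner_comm, S.N_tangent_spaceForm]

lemma inner_ψ_mvfderiv (p : M) (v : TangentSpace (𝓡 2) p) :
    pseudoInner c (S.ψ p) (𝐝 S.ψ p v) = 0 := by
  have := inner_deriv_eq_zero (S.diff_ψ p) (S.diff_ψ p) S.inner_ψ_ψ v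
  rw [pseudoInner_comm] at this
  linarith

lemma inner_N_mvfderiv_N (p : M) (v : TangentSpace (𝓡 2) p) :
    pseudoInner c (𝐝 S.N p v) (S.N p) = 0 := by
  have := inner_deriv_eq_zero (S.diff_N p) (S.diff_N p) S.N_unit v
  rw [pseudoInner_comm c (S.N p)] at this
  linarith

lemma inner_ψ_mvfderiv_N (p : M) (v : TangentSpace (𝓡 2) p) :
    pseudoInner c (𝐝 S.N p v) (S.ψ p) = 0 := by
  have := inner_deriv_eq_zero (S.diff_N p) (S.diff_ψ p) S.N_tangent_spaceForm v
  rwa [S.N_normal, add_zero] at this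

lemma tangential_N (p : M) : S.tangential p (S.N p) = 0 :=
  S.metric_ext p fun w => by rw [metric_tangential, S.N_normal, map_zero]; rfl

lemma tangential_ψ (p : M) : S.tangential p (S.ψ p) = 0 :=
  S.metric_ext p fun w => by rw [metric_tangential, S.inner_ψ_mvfderiv, map_zero]; rfl

/-- Orthogonal decomposition of an ambient vector along the surface. -/
lemma decomposition (hc : c * c = 1) (p : M) (y : 𝔼⁴) :
    y = 𝐝 S.ψ p (S.tangential p y) + (S.ε * pseudoInner c y (S.N p)) • S.N p +
      (c * pseudoInner c y (S.ψ p)) • S.ψ p := by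
  have hN : ∀ v, pseudoInner c (𝐝 S.ψ p v) (S.N p) = 0 := fun v => by
    rw [pseudoInner_comm, S.N_normal]
  have hψ : ∀ v, pseudoInner c (𝐝 S.ψ p v) (S.ψ p) = 0 := fun v => by
    rw [pseudoInner_comm, S.inner_ψ_mvfderiv]
  let Φ : (TangentSpace (𝓡 2) p × ℝ × ℝ) →ₗ[ℝ] 𝔼⁴ :=
    (𝐝 S.ψ p).toLinearMap.coprod ((LinearMap.toSpanSingleton ℝ 𝔼⁴ (S.N p)).coprod
      (LinearMap.toSpanSingleton ℝ 𝔼⁴ (S.ψ p)))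
  have hΦ : ∀ v α β, Φ (v, α, β) = 𝐝 S.ψ p v + (α • S.N p + β • S.ψ p) := fun v α β => rfl
  -- The three components are recovered by pairing, so Φ is injective; since 2 + 1 + 1 = 4, it is
  -- also surjective.
  have h1 : ∀ v α β, S.tangential p (Φ (v, α, β)) = v := fun v α β => by
    rw [hΦ, map_add, map_add, map_smul, map_smul, tangential_N, tangential_ψ, tangential_mvfderiv,
      smul_zero, smul_zero, add_zero, add_zero]
  have h2 : ∀ v α β, S.ε * pseudoInner c (Φ (v, α, β)) (S.N p) = α := fun v α β => by
    rw [hΦ, map_add, map_add, map_smul, map_smul, LinearMap.add_apply, LinearMap.add_apply, hN,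
      LinearMap.smul_apply, LinearMap.smul_apply, S.N_unit, S.inner_ψ_N]
    simp only [smul_eq_mul]
    linear_combination α * S.ε_mul_self
  have h3 : ∀ v α β, c * pseudoInner c (Φ (v, α, β)) (S.ψ p) = β := fun v α β => by
    rw [hΦ, map_add, map_add, map_smul, map_smul, LinearMap.add_apply, LinearMap.add_apply, hψ,
      LinearMap.smul_apply, LinearMap.smul_apply, S.N_tangent_spaceForm, S.inner_ψ_ψ]
    simp only [smul_eq_mul]
    linear_combination β * hc
  have hinj : Function.Injective Φ := by
    rintro ⟨v, α, β⟩ ⟨v', α', β'⟩ h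
    have e1 := h1 v α β
    have e2 := h2 v α β
    have e3 := h3 v α β
    rw [h] at e1 e2 e3
    rw [← e1, ← e2, ← e3, h1, h2, h3]
  have hsurj : Function.Surjective Φ := by
    refine (LinearMap.injective_iff_surjective_of_finrank_eq_finrank ?_).1 hinj
    rw [Module.finrank_prod, Module.finrank_prod, finrank_tangentSpace,
      finrank_euclideanSpace_fin, Module.finrank_self]
  obtain ⟨⟨v, α, β⟩, rfl⟩ := hsurj y
  rw [h1, h2, h3, hΦ, add_assoc]

/-- Weingarten's formula. -/
lemma mvfderiv_N (hc : c * c = 1) (p : M) (v : TangentSpace (𝓡 2) p) :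
    𝐝 S.N p v = -𝐝 S.ψ p (S.shape p v) := by
  have h : S.shape p v = -S.tangential p (𝐝 S.N p v) := rfl
  rw [h, map_neg, neg_neg]
  have := S.decomposition hc p (𝐝 S.N p v)
  rw [S.inner_N_mvfderiv_N, S.inner_ψ_mvfderiv_N] at this
  simpa using this

/-! ### Height and angle functions; self-adjointness of the shape operator. -/

/-- The height function `⟨a, ψ⟩`. -/
def height (a : 𝔼⁴) (q : M) : ℝ := pseudoInner c a (S.ψ q)

/-- The angle function `⟨a, N⟩`. -/
def angle (a : 𝔼⁴) (q : M) : ℝ := pseudoInner c a (S.N q)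

lemma smooth_height (a : 𝔼⁴) : IsSmooth (S.height a) := S.smooth_ψ.clm (pseudoInnerL c a)

lemma smooth_angle (a : 𝔼⁴) : IsSmooth (S.angle a) := S.smooth_N.clm (pseudoInnerL c a)

lemma mvfderiv_height (a : 𝔼⁴) (p : M) (v : TangentSpace (𝓡 2) p) :
    𝐝 (S.height a) p v = S.metric p (S.tangential p a) v := by
  rw [metric_tangential]
  exact (hasDeriv_clm (pseudoInnerL c a) (S.diff_ψ p)).2 v

lemma mvfderiv_angle (hc : c * c = 1) (a : 𝔼⁴) (p : M) (v : TangentSpace (𝓡 2) p) :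
    𝐝 (S.angle a) p v = -S.metric p (S.tangential p a) (S.shape p v) := by
  rw [metric_tangential, ← map_neg, ← S.mvfderiv_N hc]
  exact (hasDeriv_clm (pseudoInnerL c a) (S.diff_N p)).2 v

lemma mvfderiv_angle_eq (hc : c * c = 1) (a : 𝔼⁴) (p : M) (v : TangentSpace (𝓡 2) p) :
    𝐝 (S.angle a) p v = -𝐝 (S.height a) p (S.shape p v) := by
  rw [S.mvfderiv_angle hc, S.mvfderiv_height]

lemma gradient_unique {f : M → ℝ} {p : M} {u : TangentSpace (𝓡 2) p}
    (h : ∀ w, 𝐝 f p w = S.metric p u w) : S.gradient f p = u :=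
  S.metric_ext p fun w => by rw [metric_gradient, h]

lemma gradient_height (a : 𝔼⁴) (p : M) : S.gradient (S.height a) p = S.tangential p a :=
  S.gradient_unique fun w => S.mvfderiv_height a p w

lemma gradVec_height (hc : c * c = 1) (a : 𝔼⁴) (q : M) :
    S.gradVec (S.height a) q =
      a - (S.ε * S.angle a q) • S.N q - (c * S.height a q) • S.ψ q := by
  rw [gradVec, gradient_height, eq_sub_iff_add_eq, eq_sub_iff_add_eq, add_right_comm]
  exact (S.decomposition hc q a).symm

/-- The shape operator as an endomorphism of `ℝ⁴` that vanishes on the normal space. -/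
def shapeExt (q : M) : 𝔼⁴ →L[ℝ] 𝔼⁴ := -S.along S.N q

lemma shapeExt_apply (hc : c * c = 1) (q : M) (y : 𝔼⁴) :
    S.shapeExt q y = 𝐝 S.ψ q (S.shape q (S.tangential q y)) := by
  have : S.shapeExt q y = -𝐝 S.N q (S.tangential q y) := rfl
  rw [this, S.mvfderiv_N hc, neg_neg]

variable [IsManifold (𝓡 2) ∞ M]

lemma hessian_apply (f : M → ℝ) (p : M) (v : TangentSpace (𝓡 2) p) :
    S.hessian f p v = S.tangential p (𝐝 (S.gradVec f) p v) := rfl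

/-- Differentiate ∇f = a − εnN − cfψ: the derivatives of the coefficients multiply normal vectors,
so only −εn dN and −cf dψ have tangential parts. -/
lemma hessian_height (hc : c * c = 1) (a : 𝔼⁴) (p : M) (v : TangentSpace (𝓡 2) p) :
    S.hessian (S.height a) p v =
      (S.ε * S.angle a p) • S.shape p v - (c * S.height a p) • v := by
  have hn := hasDeriv_const_smul S.ε ((S.smooth_angle a).isDiffAt p)
  have hf := hasDeriv_const_smul c ((S.smooth_height a).isDiffAt p)
  have h1 := hasDeriv_smul hn.1 (S.diff_N p)
  have h2 := hasDeriv_smul hf.1 (S.diff_ψ p)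
  have h3 := hasDeriv_sub (hasDeriv_const a p).1 h1.1
  have h4 := hasDeriv_sub h3.1 h2.1
  have e : S.gradVec (S.height a) = _ := funext (S.gradVec_height hc a)
  rw [hessian_apply, e]
  refine (congrArg _ (h4.2 v)).trans ?_
  rw [h3.2, h1.2, h2.2, (hasDeriv_const a p).2, S.mvfderiv_N hc]
  simp only [map_sub, map_add, map_smul, map_neg, tangential_N, tangential_ψ, tangential_mvfderiv,
    smul_eq_mul, map_zero, smul_zero]
  simp

/-- For a = N(p) the angle function equals ε and the height vanishes at p, so S is there the Hessian
of a height function, which is symmetric. -/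
lemma shape_symm (hc : c * c = 1) (p : M) (v w : TangentSpace (𝓡 2) p) :
    S.metric p (S.shape p v) w = S.metric p (S.shape p w) v := by
  have key : ∀ v w, S.metric p (S.hessian (S.height (S.N p)) p v) w =
      pseudoInner c (𝐝 (S.gradVec (S.height (S.N p))) p v) (𝐝 S.ψ p w) := fun v w => by
    rw [hessian_apply, metric_tangential]
  have h := S.hessian_symm hc (S.smooth_height (S.N p)) p v w
  rw [← key, ← key, S.hessian_height hc, S.hessian_height hc] at h
  have h1 : S.angle (S.N p) p = S.ε := S.N_unit p
  have h2 : S.height (S.N p) p = 0 := S.N_tangent_spaceForm p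
  rw [h1, h2, S.ε_mul_self] at h
  simpa using h

lemma smooth_shapeExt : IsSmooth S.shapeExt := (S.contMDiff_along S.smooth_N).neg

end OrientedSurface

/-! ### Curvature functions, Newton transformation and the Codazzi equation. -/

namespace OrientedSurface

variable {c : ℝ} {M : Type*} [TopologicalSpace M] [ChartedSpace (EuclideanSpace ℝ (Fin 2)) M]
  (S : OrientedSurface c M)

/-- The covariant derivative `∇_v S` of the shape operator. -/
def nablaShape (p : M) (v : TangentSpace (𝓡 2) p) : Module.End ℝ (TangentSpace (𝓡 2) p) :=
  S.tangential p ∘ₗ (𝐝 S.shapeExt p v).toLinearMap ∘ₗ (𝐝 S.ψ p).toLinearMap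

lemma nablaShape_apply (p : M) (v w : TangentSpace (𝓡 2) p) :
    S.nablaShape p v w = S.tangential p (𝐝 S.shapeExt p v (𝐝 S.ψ p w)) := rfl

lemma metric_nablaShape (p : M) (v w u : TangentSpace (𝓡 2) p) :
    S.metric p (S.nablaShape p v w) u =
      pseudoInner c (𝐝 S.shapeExt p v (𝐝 S.ψ p w)) (𝐝 S.ψ p u) := by
  rw [nablaShape_apply, metric_tangential]

lemma shapeExt_mvfderiv (hc : c * c = 1) (p : M) (v : TangentSpace (𝓡 2) p) :
    S.shapeExt p (𝐝 S.ψ p v) = 𝐝 S.ψ p (S.shape p v) := by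
  rw [S.shapeExt_apply hc, tangential_mvfderiv]

lemma shapeExt_N (hc : c * c = 1) (p : M) : S.shapeExt p (S.N p) = 0 := by
  rw [S.shapeExt_apply hc, tangential_N, map_zero, map_zero]

lemma shapeExt_ψ (hc : c * c = 1) (p : M) : S.shapeExt p (S.ψ p) = 0 := by
  rw [S.shapeExt_apply hc, tangential_ψ, map_zero, map_zero]

lemma inner_shapeExt (hc : c * c = 1) (p : M) (y x : 𝔼⁴) :
    pseudoInner c (S.shapeExt p y) x =
      S.metric p (S.shape p (S.tangential p y)) (S.tangential p x) := by
  rw [S.shapeExt_apply hc, pseudoInner_comm, ← metric_tangential, metric_comm]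

lemma inner_shapeExt_N (hc : c * c = 1) (p : M) (y : 𝔼⁴) :
    pseudoInner c (S.shapeExt p y) (S.N p) = 0 := by
  rw [S.inner_shapeExt hc, tangential_N, map_zero]

lemma inner_shapeExt_ψ (hc : c * c = 1) (p : M) (y : 𝔼⁴) :
    pseudoInner c (S.shapeExt p y) (S.ψ p) = 0 := by
  rw [S.inner_shapeExt hc, tangential_ψ, map_zero]

/-- The trace as a continuous linear form on the endomorphisms of `ℝ⁴`. -/
def traceL : (𝔼⁴ →L[ℝ] 𝔼⁴) →L[ℝ] ℝ :=
  LinearMap.toContinuousLinearMap (LinearMap.trace ℝ 𝔼⁴ ∘ₗ ContinuousLinearMap.coeLM ℝ)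

lemma traceL_apply (B : 𝔼⁴ →L[ℝ] 𝔼⁴) : traceL B = LinearMap.trace ℝ 𝔼⁴ B.toLinearMap := rfl

lemma trace_shapeExt (hc : c * c = 1) (p : M) :
    traceL (S.shapeExt p) = LinearMap.trace ℝ _ (S.shape p) := by
  have h : (S.shapeExt p).toLinearMap =
      (𝐝 S.ψ p).toLinearMap ∘ₗ (S.shape p ∘ₗ S.tangential p) := by
    ext1 y; exact S.shapeExt_apply hc p y
  have h' : (S.shape p ∘ₗ S.tangential p) ∘ₗ (𝐝 S.ψ p).toLinearMap = S.shape p := by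
    ext1 v; exact congrArg (fun u => S.shape p u) (S.tangential_mvfderiv p v)
  rw [traceL_apply, h, LinearMap.trace_comp_comm', h']

lemma trace_shapeExt_comp (hc : c * c = 1) (p : M) :
    traceL ((S.shapeExt p).comp (S.shapeExt p)) =
      LinearMap.trace ℝ _ (S.shape p ∘ₗ S.shape p) := by
  have h : ((S.shapeExt p).comp (S.shapeExt p)).toLinearMap =
      (𝐝 S.ψ p).toLinearMap ∘ₗ (S.shape p ∘ₗ S.shape p ∘ₗ S.tangential p) := by
    ext1 y
    change S.shapeExt p (S.shapeExt p y) = _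
    rw [S.shapeExt_apply hc p y, S.shapeExt_mvfderiv hc]; rfl
  rw [traceL_apply, h, LinearMap.trace_comp_comm']
  congr 1
  ext1 v
  exact congrArg (fun u => S.shape p (S.shape p u)) (S.tangential_mvfderiv p v)

lemma trace_shape (p : M) :
    LinearMap.trace ℝ _ (S.shape p) = 2 * S.ε * S.meanCurvature p := by
  rw [meanCurvature]
  linear_combination -LinearMap.trace ℝ _ (S.shape p) * S.ε_mul_self

lemma meanCurvature_eq (hc : c * c = 1) :
    S.meanCurvature = fun q => (S.ε / 2) • traceL (S.shapeExt q) := by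
  ext q; rw [S.trace_shapeExt hc]; rfl

lemma shape_shape (p : M) (v : TangentSpace (𝓡 2) p) :
    S.shape p (S.shape p v) =
      (2 * S.ε * S.meanCurvature p) • S.shape p v - S.secondMeanCurvature p • v := by
  rw [cayley_hamilton_of_finrank_two (finrank_tangentSpace p), trace_shape]; rfl

lemma trace_shape_comp (p : M) : LinearMap.trace ℝ _ (S.shape p ∘ₗ S.shape p) =
    4 * S.meanCurvature p ^ 2 - 2 * S.secondMeanCurvature p := by
  rw [trace_comp_self_of_finrank_two (finrank_tangentSpace p), trace_shape, secondMeanCurvature]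
  linear_combination 4 * S.meanCurvature p ^ 2 * S.ε_mul_self

/-- Writing det S through traces of the extended shape operator is what yields the smoothness of H₂.
-/
lemma secondMeanCurvature_eq (hc : c * c = 1) :
    S.secondMeanCurvature = fun q => 2 * (S.meanCurvature q * S.meanCurvature q) -
      (1 / 2 : ℝ) • traceL ((S.shapeExt q).comp (S.shapeExt q)) := by
  ext q
  rw [S.trace_shapeExt_comp hc, trace_shape_comp, smul_eq_mul]
  ring

lemma newton_apply (p : M) (v : TangentSpace (𝓡 2) p) :
    S.newton p v = S.shape p v - (2 * S.ε * S.meanCurvature p) • v := by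
  change -(2 * S.ε * S.meanCurvature p) • v + S.shape p v = _
  module

/-- P₁ = S − (tr S)I is minus the adjugate of S, so this is Cayley–Hamilton. -/
lemma newton_shape (p : M) (v : TangentSpace (𝓡 2) p) :
    S.newton p (S.shape p v) = -S.secondMeanCurvature p • v := by
  rw [newton_apply, shape_shape]; module

lemma shape_newton (p : M) (v : TangentSpace (𝓡 2) p) :
    S.shape p (S.newton p v) = -S.secondMeanCurvature p • v := by
  rw [newton_apply, map_sub, map_smul, shape_shape]; module

lemma smooth_mul {f g : M → ℝ} (hf : IsSmooth f) (hg : IsSmooth g) :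
    IsSmooth fun q => f q * g q :=
  IsSmooth.bilin (ContinuousLinearMap.mul ℝ ℝ) hf hg

lemma gradient_angle (hc : c * c = 1) (a : 𝔼⁴) (p : M) (hS : ∀ v w,
    S.metric p (S.shape p v) w = S.metric p (S.shape p w) v) :
    S.gradient (S.angle a) p = -S.shape p (S.tangential p a) :=
  S.gradient_unique fun w => by
    rw [S.mvfderiv_angle hc, map_neg, LinearMap.neg_apply, hS, metric_comm]

lemma gradient_add {f g : M → ℝ} {p : M} (hf : IsDiffAt f p) (hg : IsDiffAt g p) :
    S.gradient (fun q => f q + g q) p = S.gradient f p + S.gradient g p :=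
  S.gradient_unique fun w => by
    rw [(hasDeriv_add hf hg).2, map_add, LinearMap.add_apply, metric_gradient, metric_gradient]

lemma gradient_mul {f g : M → ℝ} {p : M} (hf : IsDiffAt f p) (hg : IsDiffAt g p) :
    S.gradient (fun q => f q * g q) p = f p • S.gradient g p + g p • S.gradient f p :=
  S.gradient_unique fun w => by
    rw [(hasDeriv_mul hf hg).2, map_add, LinearMap.add_apply, map_smul, map_smul,
      LinearMap.smul_apply, LinearMap.smul_apply, metric_gradient, metric_gradient, smul_eq_mul,
      smul_eq_mul]
    ring

lemma gradient_const (k : ℝ) (p : M) : S.gradient (fun _ => k) p = 0 :=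
  S.gradient_unique fun w => by rw [(hasDeriv_const k p).2, map_zero]; rfl

variable [IsManifold (𝓡 2) ∞ M]

lemma diff_shapeExt (p : M) : IsDiffAt S.shapeExt p := S.smooth_shapeExt.isDiffAt p

lemma smooth_meanCurvature (hc : c * c = 1) : IsSmooth S.meanCurvature := by
  rw [S.meanCurvature_eq hc]
  exact IsSmooth.clm ((S.ε / 2) • traceL) S.smooth_shapeExt

lemma smooth_secondMeanCurvature (hc : c * c = 1) : IsSmooth S.secondMeanCurvature := by
  rw [S.secondMeanCurvature_eq hc]
  have h1 := smooth_mul (S.smooth_meanCurvature hc) (S.smooth_meanCurvature hc)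
  have h2 : IsSmooth fun q => 2 * (S.meanCurvature q * S.meanCurvature q) :=
    IsSmooth.clm ((2 : ℝ) • ContinuousLinearMap.id ℝ ℝ) h1
  have h3 := IsSmooth.bilin (ContinuousLinearMap.compL ℝ 𝔼⁴ 𝔼⁴ 𝔼⁴) S.smooth_shapeExt
    S.smooth_shapeExt
  exact h2.sub (IsSmooth.clm ((1 / 2 : ℝ) • traceL) h3)

lemma hasDeriv_shapeExt_inner (p : M) (y : 𝔼⁴) {g : M → 𝔼⁴}
    (hg : IsDiffAt g p) (h : ∀ q, pseudoInner c (S.shapeExt q y) (g q) = 0)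
    (v : TangentSpace (𝓡 2) p) :
    pseudoInner c (𝐝 S.shapeExt p v y) (g p) = -pseudoInner c (S.shapeExt p y) (𝐝 g p v) := by
  have h1 := hasDeriv_apply (S.diff_shapeExt p) (hasDeriv_const y p).1
  have h2 := inner_deriv_eq_zero h1.1 hg h v
  rw [h1.2, (hasDeriv_const y p).2, map_zero, add_zero] at h2
  linarith

lemma inner_dshapeExt_symm (hc : c * c = 1) (p : M) (v : TangentSpace (𝓡 2) p) (y x : 𝔼⁴) :
    pseudoInner c (𝐝 S.shapeExt p v y) x = pseudoInner c (𝐝 S.shapeExt p v x) y := by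
  have h1 := fun y => hasDeriv_apply (S.diff_shapeExt p) (hasDeriv_const y p).1
  have h2 := fun y x => (hasDeriv_inner (c := c) (h1 y).1 (hasDeriv_const x p).1).2 v
  have h3 : (fun q => pseudoInner c (S.shapeExt q y) x) =
      fun q => pseudoInner c (S.shapeExt q x) y := by
    ext q
    rw [S.inner_shapeExt hc, S.inner_shapeExt hc, S.shape_symm hc]
  have h4 := h2 y x
  rw [h3, h2 x y] at h4
  simp only [(h1 _).2, (hasDeriv_const _ p).2, map_zero, add_zero] at h4
  exact h4.symm

lemma nablaShape_selfAdjoint (hc : c * c = 1) (p : M) (v w u : TangentSpace (𝓡 2) p) :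
    S.metric p (S.nablaShape p v w) u = S.metric p (S.nablaShape p v u) w := by
  rw [metric_nablaShape, metric_nablaShape, S.inner_dshapeExt_symm hc]

lemma gradVec_angle (hc : c * c = 1) (a : 𝔼⁴) (q : M) :
    S.gradVec (S.angle a) q = -S.shapeExt q a := by
  rw [gradVec, S.gradient_angle hc a q (S.shape_symm hc q), map_neg, S.shapeExt_apply hc]

/-- The Codazzi equation. -/
lemma nablaShape_symm (hc : c * c = 1) (p : M) (v w : TangentSpace (𝓡 2) p) :
    S.nablaShape p v w = S.nablaShape p w v := by
  refine S.metric_ext p fun u => ?_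
  -- As ∇⟨a,N⟩ = −S aᵀ, the Hessian form of the angle function with a = dψ(u) is −⟨(∇ᵥS)u, w⟩ at p.
  -- Its symmetry, with ∇ᵥS self-adjoint, is Codazzi.
  have h := S.hessian_symm hc (S.smooth_angle (𝐝 S.ψ p u)) p v w
  have e : S.gradVec (S.angle (𝐝 S.ψ p u)) =
      fun q => -S.shapeExt q (𝐝 S.ψ p u) := funext (S.gradVec_angle hc _)
  have h1 := hasDeriv_apply (S.diff_shapeExt p) (hasDeriv_const (𝐝 S.ψ p u) p).1
  have h2 : ∀ v, 𝐝 (S.gradVec (S.angle (𝐝 S.ψ p u))) p v = -𝐝 S.shapeExt p v (𝐝 S.ψ p u) := by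
    intro v
    have h3 := (hasDeriv_const_smul (-1) h1.1).2 v
    simp only [neg_smul, one_smul] at h3
    rw [e, h3, h1.2, (hasDeriv_const _ p).2, map_zero, add_zero]
  rw [h2, h2, map_neg, LinearMap.neg_apply, map_neg, LinearMap.neg_apply, neg_inj,
    ← metric_nablaShape, ← metric_nablaShape] at h
  rw [S.nablaShape_selfAdjoint hc, h, S.nablaShape_selfAdjoint hc]

/-- Differentiate the trace of the extended shape operator. The normal directions add nothing to the
trace of the derivative B, since ⟨BN, N⟩ = ⟨Bψ, ψ⟩ = 0. -/
lemma trace_nablaShape (hc : c * c = 1) (p : M) (v : TangentSpace (𝓡 2) p) :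
    LinearMap.trace ℝ _ (S.nablaShape p v) = 2 * S.ε * 𝐝 S.meanCurvature p v := by
  set B := 𝐝 S.shapeExt p v with hB
  have hH : 𝐝 S.meanCurvature p v = S.ε / 2 * traceL B := by
    rw [S.meanCurvature_eq hc]
    exact (hasDeriv_clm ((S.ε / 2) • traceL) (S.diff_shapeExt p)).2 v
  have hN : pseudoInner c (B (S.N p)) (S.N p) = 0 := by
    rw [S.hasDeriv_shapeExt_inner p (S.N p) (S.diff_N p)
      (fun q => S.inner_shapeExt_N hc q _), S.shapeExt_N hc]; simp
  have hψ : pseudoInner c (B (S.ψ p)) (S.ψ p) = 0 := by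
    rw [S.hasDeriv_shapeExt_inner p (S.ψ p) (S.diff_ψ p)
      (fun q => S.inner_shapeExt_ψ hc q _), S.shapeExt_ψ hc]; simp
  have hdec : B.toLinearMap = (B.toLinearMap ∘ₗ (𝐝 S.ψ p).toLinearMap) ∘ₗ S.tangential p +
      (S.ε • (pseudoInner c).flip (S.N p)).smulRight (B (S.N p)) +
      (c • (pseudoInner c).flip (S.ψ p)).smulRight (B (S.ψ p)) := by
    ext1 y
    have := congrArg B (S.decomposition hc p y)
    rw [map_add, map_add, map_smul, map_smul] at this
    exact this
  have htr : traceL B = LinearMap.trace ℝ _ (S.nablaShape p v) := by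
    have hN' : (S.ε • (pseudoInner c).flip (S.N p)) (B (S.N p)) = 0 :=
      (congrArg (S.ε * ·) hN).trans (mul_zero _)
    have hψ' : (c • (pseudoInner c).flip (S.ψ p)) (B (S.ψ p)) = 0 :=
      (congrArg (c * ·) hψ).trans (mul_zero _)
    rw [traceL_apply, hdec, map_add, map_add, LinearMap.trace_smulRight, LinearMap.trace_smulRight,
      LinearMap.trace_comp_comm', hN', hψ', add_zero, add_zero]
    rfl
  rw [hH, htr]
  linear_combination -LinearMap.trace ℝ _ (S.nablaShape p v) * S.ε_mul_self

/-! ### The operator L₁: divergence form, height and angle functions, product rule. -/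

/-- The divergence of a tangent vector field, given as an `ℝ⁴`-valued map. -/
def divergence (V : M → 𝔼⁴) (p : M) : ℝ :=
  LinearMap.trace ℝ _ (S.tangential p ∘ₗ (𝐝 V p).toLinearMap)

/-- The Newton transformation of the gradient as an `ℝ⁴`-valued map. -/
def newtonGradVec (f : M → ℝ) (q : M) : 𝔼⁴ := 𝐝 S.ψ q (S.newton q (S.gradient f q))

/-- P₁ is divergence-free: by Codazzi the divergence of S is d(tr S) = 2ε dH, which cancels against
that of −2εHI. -/
lemma L₁_eq_divergence (hc : c * c = 1) {f : M → ℝ} (hf : IsSmooth f) (p : M) :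
    S.L₁ f p = S.divergence (S.newtonGradVec f) p := by
  have hg := IsSmooth.isDiffAt (S.contMDiff_gradVec hc hf) p
  have hH := hasDeriv_const_smul (2 * S.ε) ((S.smooth_meanCurvature hc).isDiffAt p)
  have h1 := hasDeriv_apply (S.diff_shapeExt p) hg
  have h2 := hasDeriv_smul hH.1 hg
  have h3 := hasDeriv_sub h1.1 h2.1
  have e : S.newtonGradVec f = fun q => S.shapeExt q (S.gradVec f q) -
      ((2 * S.ε) • S.meanCurvature q) • S.gradVec f q := by
    ext1 q
    rw [newtonGradVec, gradVec, S.shapeExt_mvfderiv hc, newton_apply, map_sub, map_smul,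
      smul_eq_mul]
  have hlin : S.tangential p ∘ₗ (𝐝 (S.newtonGradVec f) p).toLinearMap =
      S.nablaShape p (S.gradient f p) + S.newton p ∘ₗ S.hessian f p -
      ((2 * S.ε) • (𝐝 S.meanCurvature p).toLinearMap).smulRight (S.gradient f p) := by
    ext1 v
    change S.tangential p (𝐝 (S.newtonGradVec f) p v) = S.nablaShape p (S.gradient f p) v +
      S.newton p (S.hessian f p v) - (2 * S.ε * 𝐝 S.meanCurvature p v) • S.gradient f p
    rw [e, h3.2, h1.2, h2.2, hH.2, S.nablaShape_symm hc, nablaShape_apply, newton_apply,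
      S.shapeExt_apply hc]
    simp only [map_sub, map_add, map_smul, tangential_mvfderiv]
    rw [gradVec, tangential_mvfderiv, ← hessian_apply, smul_eq_mul, smul_eq_mul]
    abel
  rw [divergence, hlin, map_sub, map_add, S.trace_nablaShape hc, LinearMap.trace_smulRight, L₁]
  simp

lemma trace_hessian_height (hc : c * c = 1) (a : 𝔼⁴) (p : M) :
    LinearMap.trace ℝ _ (S.hessian (S.height a) p) =
      2 * S.meanCurvature p * S.angle a p - 2 * c * S.height a p := by
  have : S.hessian (S.height a) p = (S.ε * S.angle a p) • S.shape p -
      (c * S.height a p) • LinearMap.id := by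
    ext1 v; exact S.hessian_height hc a p v
  rw [this, map_sub, map_smul, map_smul, trace_shape, LinearMap.trace_id, finrank_tangentSpace]
  simp only [smul_eq_mul, Nat.cast_ofNat]
  linear_combination 2 * S.meanCurvature p * S.angle a p * S.ε_mul_self

/-- From P₁S = −H₂I and tr P₁ = −2εH. As a varies this says L₁ψ = −2εH₂N + 2cεHψ. -/
lemma L₁_height (hc : c * c = 1) (a : 𝔼⁴) (p : M) :
    S.L₁ (S.height a) p = -2 * S.ε * S.secondMeanCurvature p * S.angle a p +
      2 * c * S.ε * S.meanCurvature p * S.height a p := by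
  have : S.newton p ∘ₗ S.hessian (S.height a) p =
      (2 * S.ε * S.meanCurvature p * (c * S.height a p) -
        S.ε * S.angle a p * S.secondMeanCurvature p) • LinearMap.id -
      (c * S.height a p) • S.shape p := by
    ext1 v
    change S.newton p (S.hessian (S.height a) p v) = (2 * S.ε * S.meanCurvature p *
      (c * S.height a p) - S.ε * S.angle a p * S.secondMeanCurvature p) • v -
      (c * S.height a p) • S.shape p v
    rw [S.hessian_height hc, map_sub, map_smul, map_smul, newton_shape, newton_apply]
    module
  rw [L₁, this, map_sub, map_smul, map_smul, trace_shape, LinearMap.trace_id, finrank_tangentSpace]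
  simp only [smul_eq_mul, Nat.cast_ofNat]
  ring

/-- P₁∇n = −P₁S∇f = H₂∇f, so L₁n is the divergence of H₂∇f; no second derivative of N is needed. -/
lemma L₁_angle (hc : c * c = 1) (a : 𝔼⁴) (p : M) :
    S.L₁ (S.angle a) p = 𝐝 S.secondMeanCurvature p (S.tangential p a) +
      2 * S.meanCurvature p * S.secondMeanCurvature p * S.angle a p -
      2 * c * S.secondMeanCurvature p * S.height a p := by
  have hg := IsSmooth.isDiffAt (S.contMDiff_gradVec hc (S.smooth_height a)) p
  have hq := (S.smooth_secondMeanCurvature hc).isDiffAt p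
  have h1 := hasDeriv_smul hq hg
  have e : S.newtonGradVec (S.angle a) = fun q => S.secondMeanCurvature q •
      S.gradVec (S.height a) q := by
    ext1 q
    rw [newtonGradVec, gradVec, S.gradient_angle hc a q (S.shape_symm hc q), gradient_height,
      map_neg (S.newton q), newton_shape, neg_smul, neg_neg, map_smul]
  have hlin : S.tangential p ∘ₗ (𝐝 (S.newtonGradVec (S.angle a)) p).toLinearMap =
      (𝐝 S.secondMeanCurvature p).toLinearMap.smulRight (S.tangential p a) +
      S.secondMeanCurvature p • S.hessian (S.height a) p := by
    ext1 v
    change S.tangential p (𝐝 (S.newtonGradVec (S.angle a)) p v) =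
      𝐝 S.secondMeanCurvature p v • S.tangential p a +
      S.secondMeanCurvature p • S.hessian (S.height a) p v
    rw [e, h1.2, map_add, map_smul, map_smul, ← hessian_apply]
    nth_rewrite 1 [gradVec]
    rw [tangential_mvfderiv, gradient_height]
  rw [S.L₁_eq_divergence hc (S.smooth_angle a), divergence, hlin, map_add, map_smul,
    LinearMap.trace_smulRight, S.trace_hessian_height hc]
  simp only [smul_eq_mul, ContinuousLinearMap.coe_coe]
  ring

lemma hessian_const (k : ℝ) (p : M) : S.hessian (fun _ => k) p = 0 := by
  have e : S.gradVec (fun _ => k) = fun _ => 0 := by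
    ext1 q; rw [gradVec, gradient_const, map_zero]
  ext1 v
  rw [hessian_apply, e, (hasDeriv_const _ p).2, map_zero]; rfl

lemma hessian_add (hc : c * c = 1) {f g : M → ℝ} (hf : IsSmooth f) (hg : IsSmooth g) (p : M) :
    S.hessian (fun q => f q + g q) p = S.hessian f p + S.hessian g p := by
  have h1 := IsSmooth.isDiffAt (S.contMDiff_gradVec hc hf) p
  have h2 := IsSmooth.isDiffAt (S.contMDiff_gradVec hc hg) p
  have e : S.gradVec (fun q => f q + g q) = fun q => S.gradVec f q + S.gradVec g q := by
    ext1 q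
    rw [gradVec, S.gradient_add (hf.isDiffAt q) (hg.isDiffAt q), map_add]; rfl
  ext1 v
  rw [hessian_apply, e, (hasDeriv_add h1 h2).2, map_add]; rfl

lemma hessian_mul (hc : c * c = 1) {f g : M → ℝ} (hf : IsSmooth f) (hg : IsSmooth g) (p : M)
    (v : TangentSpace (𝓡 2) p) :
    S.hessian (fun q => f q * g q) p v = 𝐝 f p v • S.gradient g p + f p • S.hessian g p v +
      (𝐝 g p v • S.gradient f p + g p • S.hessian f p v) := by
  have h1 := IsSmooth.isDiffAt (S.contMDiff_gradVec hc hf) p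
  have h2 := IsSmooth.isDiffAt (S.contMDiff_gradVec hc hg) p
  have h3 := hasDeriv_smul (hf.isDiffAt p) h2
  have h4 := hasDeriv_smul (hg.isDiffAt p) h1
  have e : S.gradVec (fun q => f q * g q) = fun q => f q • S.gradVec g q + g q • S.gradVec f q := by
    ext1 q
    rw [gradVec, S.gradient_mul (hf.isDiffAt q) (hg.isDiffAt q), map_add, map_smul, map_smul]; rfl
  rw [hessian_apply, e, (hasDeriv_add h3.1 h4.1).2, h3.2, h4.2]
  simp only [map_add, map_smul, ← hessian_apply]
  rw [gradVec, gradVec, tangential_mvfderiv, tangential_mvfderiv]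

lemma L₁_const (k : ℝ) (p : M) : S.L₁ (fun _ => k) p = 0 := by
  rw [L₁, hessian_const, LinearMap.comp_zero, map_zero]

lemma L₁_add (hc : c * c = 1) {f g : M → ℝ} (hf : IsSmooth f) (hg : IsSmooth g) (p : M) :
    S.L₁ (fun q => f q + g q) p = S.L₁ f p + S.L₁ g p := by
  rw [L₁, S.hessian_add hc hf hg, LinearMap.comp_add, map_add]; rfl

lemma metric_newton (hc : c * c = 1) (p : M) (v w : TangentSpace (𝓡 2) p) :
    S.metric p (S.newton p v) w = S.metric p (S.newton p w) v := by
  rw [newton_apply, newton_apply, map_sub, map_sub, LinearMap.sub_apply, LinearMap.sub_apply,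
    S.shape_symm hc, map_smul, map_smul, LinearMap.smul_apply, LinearMap.smul_apply,
    S.metric_comm p v]

lemma mvfderiv_newton_gradient (hc : c * c = 1) (f g : M → ℝ) (p : M) :
    𝐝 f p (S.newton p (S.gradient g p)) = 𝐝 g p (S.newton p (S.gradient f p)) := by
  rw [← S.metric_gradient f, ← S.metric_gradient g, S.metric_comm, S.metric_newton hc,
    S.metric_comm]

lemma L₁_mul (hc : c * c = 1) {f g : M → ℝ} (hf : IsSmooth f) (hg : IsSmooth g) (p : M) :
    S.L₁ (fun q => f q * g q) p = f p * S.L₁ g p + g p * S.L₁ f p +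
      2 * 𝐝 f p (S.newton p (S.gradient g p)) := by
  have : S.newton p ∘ₗ S.hessian (fun q => f q * g q) p =
      (𝐝 f p).toLinearMap.smulRight (S.newton p (S.gradient g p)) +
      f p • (S.newton p ∘ₗ S.hessian g p) +
      ((𝐝 g p).toLinearMap.smulRight (S.newton p (S.gradient f p)) +
      g p • (S.newton p ∘ₗ S.hessian f p)) := by
    ext1 v
    change S.newton p (S.hessian (fun q => f q * g q) p v) =
      𝐝 f p v • S.newton p (S.gradient g p) + f p • S.newton p (S.hessian g p v) +
      (𝐝 g p v • S.newton p (S.gradient f p) + g p • S.newton p (S.hessian f p v))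
    rw [S.hessian_mul hc hf hg]
    simp only [map_add, map_smul]
  rw [L₁, this]
  simp only [map_add, map_smul, LinearMap.trace_smulRight, smul_eq_mul,
    ContinuousLinearMap.coe_coe]
  rw [← S.mvfderiv_newton_gradient hc f g, L₁, L₁]
  ring

lemma L₁_const_mul (hc : c * c = 1) (k : ℝ) {f : M → ℝ} (hf : IsSmooth f) (p : M) :
    S.L₁ (fun q => k * f q) p = k * S.L₁ f p := by
  rw [S.L₁_mul hc (f := fun _ => k) contMDiff_const hf, L₁_const, (hasDeriv_const k p).2]; ring

end OrientedSurface

lemma finite_setOf_quadratic {a : ℝ} (ha : a ≠ 0) (b d : ℝ) :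
    {x : ℝ | a * x ^ 2 + b * x + d = 0}.Finite := by
  have hP : (Polynomial.C a * Polynomial.X ^ 2 + Polynomial.C b * Polynomial.X +
      Polynomial.C d : Polynomial ℝ) ≠ 0 := fun h =>
    ha (by simpa using congrArg (fun P => Polynomial.coeff P 2) h)
  refine (Polynomial.finite_setOfPred_isRoot hP).subset fun x hx => ?_
  simpa [Polynomial.IsRoot] using hx

/-! ### The scalar equations of an L₁-2-type surface. -/

namespace OrientedSurface

variable {c : ℝ} {M : Type*} [TopologicalSpace M] [ChartedSpace (EuclideanSpace ℝ (Fin 2)) M]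

/-- Differentiation of a polynomial relation of degree at most three between two functions. -/
lemma mvfderiv_of_cubic {f g : M → ℝ} {k a b d e : ℝ} {p : M} (hf : IsDiffAt f p)
    (hg : IsDiffAt g p) (h : ∀ q, k * g q = a * f q ^ 3 + b * f q ^ 2 + d * f q + e)
    (v : TangentSpace (𝓡 2) p) :
    k * 𝐝 g p v = (3 * a * f p ^ 2 + 2 * b * f p + d) * 𝐝 f p v := by
  have h0 := hasDeriv_const_smul a hf
  have h1 := hasDeriv_add h0.1 (hasDeriv_const b p).1
  have h2 := hasDeriv_mul h1.1 hf
  have h3 := hasDeriv_add h2.1 (hasDeriv_const d p).1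
  have h4 := hasDeriv_mul h3.1 hf
  have h5 := hasDeriv_add h4.1 (hasDeriv_const e p).1
  have h6 := hasDeriv_const_smul k hg
  have he : (fun q => k • g q) = fun q => ((a • f q + b) * f q + d) * f q + e := by
    ext q; rw [smul_eq_mul, h, smul_eq_mul]; ring
  have := h6.2 v
  rw [he, h5.2, h4.2, h3.2, h2.2, h1.2, h0.2] at this
  simp only [(hasDeriv_const _ p).2, smul_eq_mul] at this
  linear_combination -this

variable [IsManifold (𝓡 2) ∞ M] (S : OrientedSurface c M)

lemma L₁_inner (hc : c * c = 1) {K : M → 𝔼⁴} (hK : IsSmooth K) {l : ℝ}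
    (h : ∀ p, S.L₁vec K p = l • K p) (b : 𝔼⁴) (p : M) :
    S.L₁ (fun q => pseudoInner c b (K q)) p = l * pseudoInner c b (K p) := by
  have hs : ∀ i, IsSmooth fun q => K q i := fun i =>
    IsSmooth.clm (EuclideanSpace.proj i : 𝔼⁴ →L[ℝ] ℝ) hK
  have hL : ∀ i, S.L₁ (fun q => K q i) p = l * K p i := fun i =>
    congrArg (fun y : 𝔼⁴ => y i) (h p)
  have hm : ∀ (k : ℝ) i, IsSmooth fun q => k * K q i := fun k i =>
    smooth_mul contMDiff_const (hs i)
  have e : (fun q => pseudoInner c b (K q)) = fun q =>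
      (-b 0) * K q 0 + (c * b 1) * K q 1 + b 2 * K q 2 + b 3 * K q 3 := by
    ext q; rw [pseudoInner_apply]; ring
  have h1 := (hm (-b 0) 0).add (hm (c * b 1) 1)
  have h2 := h1.add (hm (b 2) 2)
  have e1 := S.L₁_add hc h2 (hm (b 3) 3) p
  have e2 := S.L₁_add hc h1 (hm (b 2) 2) p
  have e3 := S.L₁_add hc (hm (-b 0) 0) (hm (c * b 1) 1) p
  rw [e]
  refine e1.trans ((congrArg (· + _) (e2.trans (congrArg (· + _) e3))).trans ?_)
  simp only [S.L₁_const_mul hc _ (hs _), hL, pseudoInner_apply]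
  ring

/-- The tangent and normal components of `L₁²ψ = (λ₁ + λ₂) L₁ψ - λ₁ λ₂ (ψ - a)`. -/
lemma IsL₁TwoType.equations {S : OrientedSurface c M} (hc : c * c = 1) (hS : S.IsL₁TwoType) :
    ∃ (a : 𝔼⁴) (l₁ l₂ : ℝ), l₁ ≠ l₂ ∧
      (∀ p (v : TangentSpace (𝓡 2) p),
        -6 * S.ε * S.secondMeanCurvature p * 𝐝 S.secondMeanCurvature p v +
          4 * c * S.ε * 𝐝 S.meanCurvature p (S.newton p v) =
          l₁ * l₂ * 𝐝 (S.height a) p v) ∧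
      (∀ p, l₁ * l₂ * S.angle a p = -2 * S.L₁ S.secondMeanCurvature p -
        4 * S.secondMeanCurvature p ^ 2 * S.meanCurvature p -
        4 * c * S.ε * S.meanCurvature p * S.secondMeanCurvature p +
        2 * (l₁ + l₂) * S.secondMeanCurvature p) ∧
      (∀ p, l₁ * l₂ * S.height a p = 4 * S.ε * S.secondMeanCurvature p ^ 2 +
        2 * S.ε * S.L₁ S.meanCurvature p + 4 * c * S.meanCurvature p ^ 2 -
        2 * S.ε * (l₁ + l₂) * S.meanCurvature p + c * (l₁ * l₂)) := by
  obtain ⟨a, ψ₁, ψ₂, l₁, l₂, hs₁, hs₂, -, -, hne, hψ, h₁, h₂⟩ := hS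
  have hεε := S.ε_mul_self
  have hH := S.smooth_meanCurvature hc
  have hq := S.smooth_secondMeanCurvature hc
  -- (L₁ − λ₁)(L₁ − λ₂) annihilates ⟨b, ψ − a⟩, for every constant vector b.
  have main : ∀ (b : 𝔼⁴) (p : M),
      S.L₁ (fun q => S.L₁ (S.height b) q) p = (l₁ + l₂) * S.L₁ (S.height b) p -
        l₁ * l₂ * (S.height b p - pseudoInner c b a) := by
    intro b p
    have hu₁ : IsSmooth fun q => pseudoInner c b (ψ₁ q) := IsSmooth.clm (pseudoInnerL c b) hs₁
    have hu₂ : IsSmooth fun q => pseudoInner c b (ψ₂ q) := IsSmooth.clm (pseudoInnerL c b) hs₂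
    have e : S.height b = fun q => pseudoInner c b a + pseudoInner c b (ψ₁ q) +
        pseudoInner c b (ψ₂ q) := by
      ext q; rw [height, hψ, map_add, map_add]
    have hL : (fun q => S.L₁ (S.height b) q) = fun q =>
        l₁ * pseudoInner c b (ψ₁ q) + l₂ * pseudoInner c b (ψ₂ q) := by
      ext q
      have hk : IsSmooth fun _ : M => pseudoInner c b a := contMDiff_const
      rw [e]
      refine (S.L₁_add hc (hk.add hu₁) hu₂ q).trans ?_
      refine (congrArg (· + _) (S.L₁_add hc hk hu₁ q)).trans ?_
      rw [S.L₁_const, S.L₁_inner hc hs₁ h₁, S.L₁_inner hc hs₂ h₂, zero_add]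
    have hLp : S.L₁ (S.height b) p = _ := congrFun hL p
    have hep : S.height b p = _ := congrFun e p
    rw [hLp, hep, hL]
    refine (S.L₁_add hc (smooth_mul contMDiff_const hu₁) (smooth_mul contMDiff_const hu₂) p).trans ?_
    rw [S.L₁_const_mul hc l₁ hu₁, S.L₁_const_mul hc l₂ hu₂, S.L₁_inner hc hs₁ h₁,
      S.L₁_inner hc hs₂ h₂]
    ring
  -- The same identity with L₁²⟨b,ψ⟩ expanded by applying L₁ to −2εH₂⟨b,N⟩ + 2cεH⟨b,ψ⟩.
  have main' : ∀ (b : 𝔼⁴) (p : M),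
      -2 * S.ε * (S.secondMeanCurvature p * (𝐝 S.secondMeanCurvature p (S.tangential p b) +
        2 * S.meanCurvature p * S.secondMeanCurvature p * S.angle b p -
        2 * c * S.secondMeanCurvature p * S.height b p) +
        S.angle b p * S.L₁ S.secondMeanCurvature p +
        2 * (S.secondMeanCurvature p * 𝐝 S.secondMeanCurvature p (S.tangential p b))) +
      2 * c * S.ε * (S.meanCurvature p * (-2 * S.ε * S.secondMeanCurvature p * S.angle b p +
        2 * c * S.ε * S.meanCurvature p * S.height b p) + S.height b p * S.L₁ S.meanCurvature p +
        2 * 𝐝 S.meanCurvature p (S.newton p (S.tangential p b))) =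
      (l₁ + l₂) * (-2 * S.ε * S.secondMeanCurvature p * S.angle b p +
        2 * c * S.ε * S.meanCurvature p * S.height b p) -
        l₁ * l₂ * (S.height b p - pseudoInner c b a) := by
    intro b p
    rw [← S.L₁_height hc, ← main]
    have e : (fun q => S.L₁ (S.height b) q) = fun q =>
        (-2 * S.ε) * (S.secondMeanCurvature q * S.angle b q) +
        (2 * c * S.ε) * (S.meanCurvature q * S.height b q) := by
      ext q; rw [S.L₁_height hc]; ring
    have hqn := smooth_mul hq (S.smooth_angle b)
    have hHf := smooth_mul hH (S.smooth_height b)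
    rw [e, S.L₁_add hc (smooth_mul contMDiff_const hqn) (smooth_mul contMDiff_const hHf),
      S.L₁_const_mul hc _ hqn, S.L₁_const_mul hc _ hHf, S.L₁_mul hc hq (S.smooth_angle b),
      S.L₁_mul hc hH (S.smooth_height b), S.L₁_angle hc, S.L₁_height hc, gradient_height,
      S.gradient_angle hc b p (S.shape_symm hc p), map_neg (S.newton p), newton_shape, neg_smul,
      neg_neg, map_smul, smul_eq_mul]
  -- The components at p come from the choices b = dψ(v), N(p) and ψ(p).
  refine ⟨a, l₁, l₂, hne, fun p v => ?_, fun p => ?_, fun p => ?_⟩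
  · have h := main' (𝐝 S.ψ p v) p
    have hn : S.angle (𝐝 S.ψ p v) p = 0 := by
      rw [angle, pseudoInner_comm, S.N_normal]
    have hf : S.height (𝐝 S.ψ p v) p = 0 := by
      rw [height, pseudoInner_comm, S.inner_ψ_mvfderiv]
    have ha : pseudoInner c (𝐝 S.ψ p v) a = 𝐝 (S.height a) p v := by
      rw [mvfderiv_height, metric_tangential, pseudoInner_comm]
    rw [hn, hf, ha, tangential_mvfderiv] at h
    linear_combination h
  · have h := main' (S.N p) p
    have hn : S.angle (S.N p) p = S.ε := S.N_unit p
    have hf : S.height (S.N p) p = 0 := S.N_tangent_spaceForm p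
    have ha : pseudoInner c (S.N p) a = S.angle a p := by rw [pseudoInner_comm]; rfl
    rw [hn, hf, ha, tangential_N, map_zero, map_zero, map_zero] at h
    linear_combination -h + (4 * S.meanCurvature p * S.secondMeanCurvature p ^ 2 +
      2 * S.L₁ S.secondMeanCurvature p + 4 * c * S.meanCurvature p * S.secondMeanCurvature p * S.ε -
      2 * (l₁ + l₂) * S.secondMeanCurvature p) * (-hεε)
  · have h := main' (S.ψ p) p
    have hn : S.angle (S.ψ p) p = 0 := S.inner_ψ_N p
    have hf : S.height (S.ψ p) p = c := S.inner_ψ_ψ p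
    have ha : pseudoInner c (S.ψ p) a = S.height a p := by rw [pseudoInner_comm]; rfl
    rw [hn, hf, ha, tangential_ψ, map_zero, map_zero, map_zero] at h
    linear_combination -h + (4 * S.ε * S.secondMeanCurvature p ^ 2 +
      2 * S.ε * S.L₁ S.meanCurvature p - 2 * (l₁ + l₂) * S.ε * S.meanCurvature p +
      4 * c * S.meanCurvature p ^ 2 * S.ε ^ 2) * hc + 4 * c * S.meanCurvature p ^ 2 * hεε

/-- If `dw = g df`, then `dg` and `df` are proportional. -/
lemma wedge_eq_zero (S : OrientedSurface c M) (hc : c * c = 1) {w g f : M → ℝ}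
    (hw : IsSmooth w) (hg : IsSmooth g) (hf : IsSmooth f) (h : ∀ p v, 𝐝 w p v = g p * 𝐝 f p v) (p : M) (v u : TangentSpace (𝓡 2) p) :
    𝐝 g p v * 𝐝 f p u = 𝐝 g p u * 𝐝 f p v := by
  -- From ∇w = g∇f, the Hessian of w is dg ⊗ df + g∇²f; both Hessians are symmetric, hence so is dg
  -- ⊗ df.
  have e : S.gradVec w = fun q => g q • S.gradVec f q := by
    ext1 q
    have : S.gradient w q = g q • S.gradient f q := S.gradient_unique fun u => by
      rw [map_smul, LinearMap.smul_apply, metric_gradient, h, smul_eq_mul]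
    rw [gradVec, this, map_smul]; rfl
  have h1 := hasDeriv_smul (hg.isDiffAt p) (IsSmooth.isDiffAt (S.contMDiff_gradVec hc hf) p)
  have h2 := S.hessian_symm hc hw p v u
  have h3 := S.hessian_symm hc hf p v u
  simp only [e, h1.2, map_add, map_smul, LinearMap.add_apply, LinearMap.smul_apply, smul_eq_mul,
    h3, S.pseudoInner_gradVec, along_mvfderiv] at h2
  linarith

end OrientedSurface

/-! ### Constancy of H or H₂ from the equations. -/

namespace OrientedSurface

variable {c : ℝ} {M : Type*} [TopologicalSpace M] [ChartedSpace (EuclideanSpace ℝ (Fin 2)) M]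

lemma mvfderiv_of_eq_const {f : M → ℝ} {k : ℝ} (h : ∀ p, f p = k) (p : M)
    (v : TangentSpace (𝓡 2) p) : 𝐝 f p v = 0 := by
  rw [show f = fun _ => k from funext h, (hasDeriv_const k p).2]

variable {S : OrientedSurface c M}

lemma newton_newton (p : M) (v : TangentSpace (𝓡 2) p) :
    S.newton p (S.newton p v) = -(2 * S.ε * S.meanCurvature p) • S.newton p v -
      S.secondMeanCurvature p • v := by
  nth_rewrite 1 [newton_apply]
  rw [shape_newton]; module

/-- If `dH ∘ P₁ = μ dH` then `μ` is an eigenvalue of `P₁` wherever `dH` does not vanish. -/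
lemma newton_eigenvalue {p : M} {μ : ℝ}
    (h : ∀ v, 𝐝 S.meanCurvature p (S.newton p v) = μ * 𝐝 S.meanCurvature p v)
    {v : TangentSpace (𝓡 2) p} (hv : 𝐝 S.meanCurvature p v ≠ 0) :
    μ ^ 2 + 2 * S.ε * S.meanCurvature p * μ + S.secondMeanCurvature p = 0 := by
  have h1 := h (S.newton p v)
  rw [newton_newton, map_sub, map_smul, map_smul, h, smul_eq_mul, smul_eq_mul] at h1
  refine (mul_eq_zero.1 ?_).resolve_right hv
  linear_combination -h1

lemma secondMeanCurvature_of_eigenvalue {p : M} {κ : ℝ}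
    (h : Module.End.HasEigenvalue (S.shape p) κ) :
    S.secondMeanCurvature p = 2 * S.ε * κ * S.meanCurvature p - κ ^ 2 := by
  obtain ⟨v, hv⟩ := h.exists_hasEigenvector
  have h1 := S.shape_shape p v
  rw [hv.apply_eq_smul, map_smul, hv.apply_eq_smul, smul_smul, smul_smul, ← sub_smul] at h1
  have h2 := smul_left_injective ℝ hv.2 h1
  linarith

variable [IsManifold (𝓡 2) ∞ M]

lemma L₁_of_eq_const {f : M → ℝ} {k : ℝ} (h : ∀ p, f p = k) (p : M) : S.L₁ f p = 0 := by
  rw [show f = fun _ => k from funext h, L₁_const]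

lemma IsL₁TwoType.secondMeanCurvature_const [ConnectedSpace M] (hc : c * c = 1)
    (hS : S.IsL₁TwoType) (h : S.HasConstantMeanCurvature) :
    S.HasConstantSecondMeanCurvature := by
  obtain ⟨a, l₁, l₂, -, E1, -, E3⟩ := hS.equations hc
  obtain ⟨k, hk⟩ := h
  refine S.eq_of_mem_finite (S.smooth_secondMeanCurvature hc) (Set.finite_singleton 0) ?_
  rintro p ⟨v, hv⟩
  have e1 := E1 p v
  -- With H constant, E3 gives l df = 8εH₂ dH₂, whereas E1 gives l df = −6εH₂ dH₂; the difference is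
  -- 14εH₂ dH₂ = 0.
  have e3 := mvfderiv_of_cubic (k := l₁ * l₂) (a := 0) (b := 4 * S.ε) (d := 0)
    (e := 4 * c * k ^ 2 - 2 * S.ε * (l₁ + l₂) * k + c * (l₁ * l₂))
    ((S.smooth_secondMeanCurvature hc).isDiffAt p) ((S.smooth_height a).isDiffAt p) (by
      intro q
      rw [E3, hk, L₁_of_eq_const hk]
      ring) v
  rw [mvfderiv_of_eq_const hk, e3] at e1
  have : S.secondMeanCurvature p * 𝐝 S.secondMeanCurvature p v = 0 := by
    linear_combination (-S.ε / 14) * e1 -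
      S.secondMeanCurvature p * 𝐝 S.secondMeanCurvature p v * S.ε_mul_self
  exact (mul_eq_zero.1 this).resolve_right hv

/-- Take the divergence of kP₁∇H = l∇f; on the left it is kL₁H because P₁ is divergence-free. -/
lemma trace_newton_hessian_of_proportional (hc : c * c = 1) {a : 𝔼⁴} {k l : ℝ}
    (h : ∀ p v, k * 𝐝 S.meanCurvature p (S.newton p v) = l * 𝐝 (S.height a) p v) (p : M) :
    k * S.L₁ S.meanCurvature p =
      l * (2 * S.meanCurvature p * S.angle a p - 2 * c * S.height a p) := by
  have e : (fun q => k • S.newtonGradVec S.meanCurvature q) =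
      fun q => l • S.gradVec (S.height a) q := by
    ext1 q
    refine (map_smul (𝐝 S.ψ q) k _).symm.trans ((congrArg (fun u => 𝐝 S.ψ q u)
      (S.metric_ext q fun v => ?_)).trans (map_smul (𝐝 S.ψ q) l _))
    have := h q v
    rw [map_smul, map_smul, LinearMap.smul_apply, LinearMap.smul_apply, metric_gradient,
      S.metric_newton hc, metric_comm, metric_gradient]
    exact this
  have hP : IsDiffAt (S.newtonGradVec S.meanCurvature) p := by
    have hg := IsSmooth.isDiffAt (S.contMDiff_gradVec hc (S.smooth_meanCurvature hc)) p
    have hH := hasDeriv_const_smul (2 * S.ε) ((S.smooth_meanCurvature hc).isDiffAt p)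
    have e : S.newtonGradVec S.meanCurvature = fun q =>
        S.shapeExt q (S.gradVec S.meanCurvature q) -
        ((2 * S.ε) • S.meanCurvature q) • S.gradVec S.meanCurvature q := by
      ext1 q
      rw [newtonGradVec, gradVec, S.shapeExt_mvfderiv hc, newton_apply, map_sub, map_smul,
        smul_eq_mul]
    rw [e]
    exact (hasDeriv_sub (hasDeriv_apply (S.diff_shapeExt p) hg).1 (hasDeriv_smul hH.1 hg).1).1
  have hV := IsSmooth.isDiffAt (S.contMDiff_gradVec hc (S.smooth_height a)) p
  have h1 : ∀ (k : ℝ) {V : M → 𝔼⁴}, IsDiffAt V p →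
      S.divergence (fun q => k • V q) p = k * S.divergence V p := by
    intro k V hV
    have : S.tangential p ∘ₗ (𝐝 (fun q => k • V q) p).toLinearMap =
        k • (S.tangential p ∘ₗ (𝐝 V p).toLinearMap) := by
      ext1 v
      change S.tangential p (𝐝 (fun q => k • V q) p v) = k • S.tangential p (𝐝 V p v)
      rw [(hasDeriv_const_smul k hV).2, map_smul]
    rw [divergence, this, map_smul, smul_eq_mul]; rfl
  have h2 := congrArg (fun V => S.divergence V p) e
  simp only [h1 k hP, h1 l hV] at h2
  rw [S.L₁_eq_divergence hc (S.smooth_meanCurvature hc), h2, ← S.trace_hessian_height hc]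
  rfl

lemma IsL₁TwoType.meanCurvature_const_of_second [ConnectedSpace M] (hc : c * c = 1)
    (hS : S.IsL₁TwoType) (h : S.HasConstantSecondMeanCurvature) :
    S.HasConstantMeanCurvature := by
  obtain ⟨a, l₁, l₂, -, E1, E2, E3⟩ := hS.equations hc
  obtain ⟨k, hk⟩ := h
  have hεε := S.ε_mul_self
  set m : ℝ := -4 * k ^ 2 - 4 * c * S.ε * k with hm
  have E1' : ∀ p v, 4 * c * S.ε * 𝐝 S.meanCurvature p (S.newton p v) =
      l₁ * l₂ * 𝐝 (S.height a) p v := fun p v => by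
    rw [← E1, mvfderiv_of_eq_const hk]; ring
  have E2' : ∀ p, l₁ * l₂ * S.angle a p = m * S.meanCurvature p + 2 * (l₁ + l₂) * k := fun p => by
    rw [E2, hk, L₁_of_eq_const hk]; ring
  have hH := S.smooth_meanCurvature hc
  -- E1 on S v and the derivative of E2 combine to −4k(k + 2cε) dH = 0, which is decisive only when
  -- the coefficient is nonzero.
  by_cases hcase : k * (k + 2 * c * S.ε) = 0
  · set s : ℝ := 2 * (l₁ + l₂) * k with hs
    set e : ℝ := 1 + m / 4 with he
    set t : ℝ := S.ε * (s - 2 * c * S.ε * (l₁ + l₂)) / 8 with ht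
    -- The leading coefficient of the quadratic for H: e = 1 if k = 0, and e = −1 if k = −2cε.
    have he2 : e ^ 2 + 2 * e ≠ 0 := by
      rcases mul_eq_zero.1 hcase with h0 | h0
      · have : e = 1 := by rw [he, hm, h0]; ring
        rw [this]; norm_num
      · have : e = -1 := by
          rw [he, hm, show k = -2 * c * S.ε by linarith]
          linear_combination -2 * S.ε * S.ε * hc - 2 * hεε
        rw [this]; norm_num
    refine S.eq_of_mem_finite hH
      (finite_setOf_quadratic he2 (2 * S.ε * t * (e + 1)) (t ^ 2 + k)) ?_
    rintro p ⟨v, hv⟩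
    -- The divergence of E1 eliminates L₁H from E3, and E2 eliminates n. Comparing the derivative
    -- with E1 gives dH∘P₁ = (εeH + t) dH.
    have hf : ∀ q, 2 * c * (l₁ * l₂) * S.height a q = 0 * S.meanCurvature q ^ 3 +
        (4 + m) * S.meanCurvature q ^ 2 + (s - 2 * c * S.ε * (l₁ + l₂)) * S.meanCurvature q +
        (4 * c * S.ε * k ^ 2 + l₁ * l₂) := by
      intro q
      have h1 := trace_newton_hessian_of_proportional hc E1' q
      have h2 := E2' q
      have h3 := E3 q
      rw [hk] at h3
      linear_combination c * h3 + (1 / 2) * h1 + S.meanCurvature q * h2 +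
        (4 * S.meanCurvature q ^ 2 + l₁ * l₂) * hc
    have hd := mvfderiv_of_cubic (hH.isDiffAt p) ((S.smooth_height a).isDiffAt p) hf
    have hμ : ∀ w, 𝐝 S.meanCurvature p (S.newton p w) =
        (S.ε * e * S.meanCurvature p + t) * 𝐝 S.meanCurvature p w := by
      intro w
      have h1 := E1' p w
      have h2 := hd w
      rw [ht, he]
      linear_combination (S.ε / 8) * h2 + (c * S.ε / 4) * h1 -
        (c ^ 2 * 𝐝 S.meanCurvature p (S.newton p w)) * hεε -
        (𝐝 S.meanCurvature p (S.newton p w)) * hc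
    have h1 := newton_eigenvalue hμ hv
    rw [hk] at h1
    change (e ^ 2 + 2 * e) * S.meanCurvature p ^ 2 + 2 * S.ε * t * (e + 1) * S.meanCurvature p +
      (t ^ 2 + k) = 0
    linear_combination h1 - (e ^ 2 + 2 * e) * S.meanCurvature p ^ 2 * hεε
  · refine S.eq_of_mem_finite hH Set.finite_empty ?_
    rintro p ⟨v, hv⟩
    have h1 := E1' p (S.shape p v)
    have h2 := mvfderiv_of_cubic (k := l₁ * l₂) (a := 0) (b := 0) (d := m)
      (e := 2 * (l₁ + l₂) * k) (hH.isDiffAt p) ((S.smooth_angle a).isDiffAt p)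
      (fun q => by rw [E2']; ring) v
    rw [S.mvfderiv_angle_eq hc] at h2
    rw [newton_shape, map_smul, smul_eq_mul, hk] at h1
    refine hcase ((mul_eq_zero.1 ?_).resolve_right hv)
    rw [hm] at h2
    linear_combination (1 / 4 : ℝ) * (h2 - h1)

lemma IsL₁TwoType.meanCurvature_const_of_principal [ConnectedSpace M] (hc : c * c = 1)
    (hS : S.IsL₁TwoType) (h : S.HasConstantPrincipalCurvature) :
    S.HasConstantMeanCurvature := by
  obtain ⟨κ, hκ⟩ := h
  obtain ⟨r, hr⟩ : ∃ r, r = 2 * S.ε * κ := ⟨_, rfl⟩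
  have hq : ∀ p, S.secondMeanCurvature p = r * S.meanCurvature p - κ ^ 2 :=
    fun p => hr ▸ secondMeanCurvature_of_eigenvalue (hκ p)
  -- For κ = 0 also H₂ = 0. For κ ≠ 0 the leading coefficients 48κ² and 96κ² below are nonzero.
  by_cases hκ0 : κ = 0
  · exact hS.meanCurvature_const_of_second hc ⟨0, fun p => by rw [hq, hr, hκ0]; ring⟩
  obtain ⟨a, l₁, l₂, -, E1, E2, E3⟩ := hS.equations hc
  have hεε := S.ε_mul_self
  have hH := S.smooth_meanCurvature hc
  have hr2 : r ^ 2 = 4 * κ ^ 2 := by rw [hr]; linear_combination 4 * κ ^ 2 * hεε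
  have hεr : S.ε * r = 2 * κ := by rw [hr]; linear_combination 2 * κ * hεε
  have hdq : ∀ p v, 𝐝 S.secondMeanCurvature p v = r * 𝐝 S.meanCurvature p v := by
    intro p v
    rw [← one_mul (𝐝 S.secondMeanCurvature p v), mvfderiv_of_cubic (a := 0) (b := 0) (d := r)
      (e := -κ ^ 2) (hH.isDiffAt p) ((S.smooth_secondMeanCurvature hc).isDiffAt p)
      (fun q => by rw [hq]; ring) v]
    ring
  have hLq : ∀ p, S.L₁ S.secondMeanCurvature p = r * S.L₁ S.meanCurvature p := by
    intro p
    have e : S.secondMeanCurvature = fun q => r * S.meanCurvature q + -κ ^ 2 := by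
      ext q; rw [hq]; ring
    rw [e, S.L₁_add hc (smooth_mul contMDiff_const hH) contMDiff_const, L₁_const,
      S.L₁_const_mul hc _ hH, add_zero]
  have hκ2 : (48 : ℝ) * κ ^ 2 ≠ 0 := by positivity
  have hκ3 : (96 : ℝ) * κ ^ 2 ≠ 0 := by positivity
  refine S.eq_of_mem_finite hH
    ((finite_setOf_quadratic hκ2 (-60 * κ ^ 2 * r - 8 * c * κ) (48 * κ ^ 4)).union
      (finite_setOf_quadratic hκ3 (-96 * κ ^ 2 * r + 8 * c * κ)
        (72 * κ ^ 4 - 16 * c * S.ε * κ ^ 2))) ?_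
  rintro p ⟨v, hv⟩
  -- In E2 + 2κE3 the terms in L₁H cancel, because L₁H₂ = 2εκ L₁H.
  have hF : ∀ q, l₁ * l₂ * (S.angle a q + (2 * κ) • S.height a q) =
      (-4 * r ^ 2) * S.meanCurvature q ^ 3 +
      (8 * r * κ ^ 2 - 4 * c * S.ε * r + 4 * r ^ 3 + 8 * c * κ) * S.meanCurvature q ^ 2 +
      (-4 * κ ^ 4 + 4 * c * S.ε * κ ^ 2 - 8 * r ^ 2 * κ ^ 2) * S.meanCurvature q +
      (4 * r * κ ^ 4 + 2 * κ * c * (l₁ * l₂) - 2 * (l₁ + l₂) * κ ^ 2) := by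
    intro q
    have h2 := E2 q
    have h3 := E3 q
    rw [hLq, hq] at h2
    rw [hq] at h3
    rw [smul_eq_mul]
    linear_combination h2 + 2 * κ * h3 - (2 * S.L₁ S.meanCurvature q +
      4 * (r * S.meanCurvature q - κ ^ 2) ^ 2 - 2 * (l₁ + l₂) * S.meanCurvature q) * hr
  have hdF : ∀ w, l₁ * l₂ * (2 * κ * 𝐝 (S.height a) p w - 𝐝 (S.height a) p (S.shape p w)) =
      (-48 * κ ^ 2 * S.meanCurvature p ^ 2 + 48 * κ ^ 2 * r * S.meanCurvature p +
        (4 * c * S.ε * κ ^ 2 - 36 * κ ^ 4)) * 𝐝 S.meanCurvature p w := by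
    intro w
    have hk := hasDeriv_const_smul (2 * κ) ((S.smooth_height a).isDiffAt p)
    have hs := hasDeriv_add ((S.smooth_angle a).isDiffAt p) hk.1
    have := mvfderiv_of_cubic (hH.isDiffAt p) hs.1 hF w
    rw [hs.2, hk.2, S.mvfderiv_angle_eq hc, smul_eq_mul] at this
    linear_combination this + ((-12 * S.meanCurvature p ^ 2 + 8 * r * S.meanCurvature p -
      8 * κ ^ 2) * hr2 - 8 * c * S.meanCurvature p * hεr) * 𝐝 S.meanCurvature p w
  set x := 𝐝 S.meanCurvature p v with hx
  set y := 𝐝 S.meanCurvature p (S.shape p v) with hy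
  set H := S.meanCurvature p with hHp
  set q := S.secondMeanCurvature p with hqp
  set α : ℝ := 12 * κ * q + 8 * c * S.ε * κ with hα
  set β : ℝ := -24 * κ ^ 2 * q - 16 * c * κ * H + 4 * c * S.ε * q -
    (-48 * κ ^ 2 * H ^ 2 + 48 * κ ^ 2 * r * H + (4 * c * S.ε * κ ^ 2 - 36 * κ ^ 4)) with hβ
  -- E1 is applied to (2κ − S)w so that its right side is the left side of `hdF`.
  have key : ∀ w, α * 𝐝 S.meanCurvature p (S.shape p w) + β * 𝐝 S.meanCurvature p w = 0 := by
    intro w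
    have h1 := E1 p ((2 * κ) • w - S.shape p w)
    have h2 := hdF w
    rw [hdq] at h1
    have e1 : S.newton p ((2 * κ) • w - S.shape p w) =
        (2 * κ) • S.shape p w - (2 * κ * (2 * S.ε * H)) • w + q • w := by
      rw [map_sub, newton_shape, map_smul, newton_apply]; module
    rw [e1] at h1
    simp only [map_add, map_sub, map_smul, smul_eq_mul] at h1
    linear_combination h1 + h2 + 6 * q * (2 * κ * 𝐝 S.meanCurvature p w -
      𝐝 S.meanCurvature p (S.shape p w)) * hεr + 16 * c * κ * H * 𝐝 S.meanCurvature p w * hεε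
  have k1 := key v
  have k2 := key (S.shape p v)
  rw [shape_shape, map_sub, map_smul, map_smul, smul_eq_mul, smul_eq_mul] at k2
  have hqH : q = r * H - κ ^ 2 := hq p
  -- dH∘(αS + β) = 0 with dH ≠ 0 forces det(αS + β) = 0; the eigenvalues of S are κ and 2εH − κ.
  -- Each factor is quadratic in H.
  have hprod : (α * κ + β) * (α * (2 * S.ε * H - κ) + β) = 0 := by
    refine (mul_eq_zero.1 ?_).resolve_right hv
    linear_combination -α * k2 + (2 * S.ε * H * α + β) * k1 - α ^ 2 * x * hqH - α ^ 2 * x * H * hr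
  rcases mul_eq_zero.1 hprod with h0 | h0
  · left
    change 48 * κ ^ 2 * H ^ 2 + (-60 * κ ^ 2 * r - 8 * c * κ) * H + 48 * κ ^ 4 = 0
    rw [hα, hβ, hqH] at h0
    linear_combination h0 - 4 * c * H * hεr
  · right
    change 96 * κ ^ 2 * H ^ 2 + (-96 * κ ^ 2 * r + 8 * c * κ) * H +
      (72 * κ ^ 4 - 16 * c * S.ε * κ ^ 2) = 0
    rw [hα, hβ, hqH] at h0
    linear_combination h0 - (24 * κ * H ^ 2 + 4 * c * H) * hεr - 16 * c * κ * H * hεε -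
      12 * κ ^ 2 * H * hr

end OrientedSurface

/-! ### Constant H and H₂: excluding the case without real principal curvatures. -/

namespace OrientedSurface

variable {c : ℝ} {M : Type*} [TopologicalSpace M] [ChartedSpace (EuclideanSpace ℝ (Fin 2)) M]

variable {S : OrientedSurface c M}

lemma hasEigenvalue_of_root {p : M} {κ : ℝ}
    (h : κ ^ 2 - 2 * S.ε * S.meanCurvature p * κ + S.secondMeanCurvature p = 0) :
    Module.End.HasEigenvalue (S.shape p) κ := by
  rw [Module.End.hasEigenvalue_iff_isRoot_charpoly,
    charpoly_of_finrank_two (finrank_tangentSpace p), trace_shape]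
  simpa [Polynomial.IsRoot, secondMeanCurvature] using h

lemma exists_ne_zero_tangent (p : M) : ∃ v : TangentSpace (𝓡 2) p, v ≠ 0 :=
  exists_ne (α := EuclideanSpace ℝ (Fin 2)) 0

/-- There are no real principal curvatures where `H² < H₂`. -/
lemma shape_ne_smul {p : M} (h : S.meanCurvature p ^ 2 < S.secondMeanCurvature p) {κ : ℝ}
    {v : TangentSpace (𝓡 2) p} (hv : v ≠ 0) : S.shape p v ≠ κ • v := by
  intro hκ
  have := secondMeanCurvature_of_eigenvalue
    (Module.End.hasEigenvalue_of_hasEigenvector (Module.End.hasEigenvector_iff.2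
      ⟨Module.End.mem_eigenspace_iff.2 hκ, hv⟩))
  nlinarith [sq_nonneg (κ - S.ε * S.meanCurvature p), S.ε_mul_self]

variable [IsManifold (𝓡 2) ∞ M]

/-- A surface with constant `H` and `H₂`, without real principal curvatures, has parallel shape
operator. -/
lemma nablaShape_eq_zero (hc : c * c = 1) {h k : ℝ} (hH : ∀ p, S.meanCurvature p = h)
    (hK : ∀ p, S.secondMeanCurvature p = k) (hlt : h ^ 2 < k) (p : M)
    (v w : TangentSpace (𝓡 2) p) : S.nablaShape p v w = 0 := by
  -- Differentiate S² = 2εhS − kI on ℝ⁴. There I is the tangential projection y ↦ ∇⟨y,ψ⟩, whose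
  -- derivative at p has no tangential part when y is tangent at p.
  have hanti : ∀ v w, S.nablaShape p v (S.shape p w) =
      (2 * S.ε * h) • S.nablaShape p v w - S.shape p (S.nablaShape p v w) := by
    intro v w
    set y := 𝐝 S.ψ p w with hy
    have h0 := hasDeriv_apply (S.diff_shapeExt p) (hasDeriv_const y p).1
    have h1 := hasDeriv_apply (S.diff_shapeExt p) h0.1
    have hg := IsSmooth.isDiffAt (S.contMDiff_gradVec hc (S.smooth_height y)) p
    have h2 := hasDeriv_const_smul (2 * S.ε * h) h0.1
    have h3 := hasDeriv_const_smul k hg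
    have h4 := hasDeriv_sub h2.1 h3.1
    have e : (fun q => S.shapeExt q (S.shapeExt q y)) = fun q =>
        (2 * S.ε * h) • S.shapeExt q y - k • S.gradVec (S.height y) q := by
      ext1 q
      rw [S.shapeExt_apply hc q y, S.shapeExt_mvfderiv hc, shape_shape, hH, hK, gradVec,
        gradient_height, map_sub, map_smul, map_smul]
    have h5 := h1.2 v
    rw [e, h4.2, h3.2, h2.2, h0.2, (hasDeriv_const y p).2, map_zero, add_zero] at h5
    have h6 := congrArg (S.tangential p) h5
    have hn : S.angle y p = 0 := by rw [angle, pseudoInner_comm, hy, S.N_normal]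
    have hf : S.height y p = 0 := by rw [height, pseudoInner_comm, hy, S.inner_ψ_mvfderiv]
    rw [map_sub, map_smul, map_smul, ← hessian_apply, S.hessian_height hc, hn, hf, map_add,
      S.shapeExt_apply hc _ (𝐝 S.shapeExt p v y), tangential_mvfderiv, hy,
      S.shapeExt_mvfderiv hc, ← nablaShape_apply, ← nablaShape_apply] at h6
    rw [eq_sub_iff_add_eq, ← h6]
    simp
  -- The traceless part of S, with J² a negative multiple of the identity; the relation above says
  -- that ∇ᵥS anticommutes with J.
  set J : Module.End ℝ (TangentSpace (𝓡 2) p) := S.shape p - (S.ε * h) • LinearMap.id with hJ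
  have hJa : ∀ w, J w = S.shape p w - (S.ε * h) • w := fun w => rfl
  have hJJ : ∀ w, J (J w) = (h ^ 2 - k) • w := by
    intro w
    rw [hJa, hJa, map_sub, map_smul, shape_shape, hH, hK]
    have : h ^ 2 = S.ε * h * (S.ε * h) := by linear_combination -h ^ 2 * S.ε_mul_self
    rw [this]
    module
  have hJsymm : ∀ u w, S.metric p (J u) w = S.metric p u (J w) := by
    intro u w
    rw [hJa, hJa, map_sub, LinearMap.sub_apply, map_sub, S.shape_symm hc,
      S.metric_comm p u (S.shape p w), map_smul, map_smul, LinearMap.smul_apply]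
  have ha : ∀ v w u, S.metric p (S.nablaShape p v (J w)) u =
      -S.metric p (S.nablaShape p v w) (J u) := by
    intro v w u
    rw [← hJsymm, ← LinearMap.neg_apply, ← map_neg, hJa, hJa, map_sub, hanti, map_smul]
    congr 2
    module
  have hs := S.nablaShape_selfAdjoint hc p
  -- The form ⟨(∇ᵥS)w, u⟩ is totally symmetric, and moving J between two slots changes its sign.
  -- Passing from the first slot to the third directly gives −, and through the second gives +.
  have hzero : ∀ v w u, S.metric p (S.nablaShape p v w) (J u) = 0 := by
    intro v w u
    have h1 : S.metric p (S.nablaShape p (J v) w) u = -S.metric p (S.nablaShape p v w) (J u) := by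
      rw [S.nablaShape_symm hc, ha, S.nablaShape_symm hc]
    have h2 : S.metric p (S.nablaShape p (J v) w) u = S.metric p (S.nablaShape p v w) (J u) := by
      rw [hs, S.nablaShape_symm hc, ha, S.nablaShape_symm hc p u v, hs, ha, neg_neg]
    linarith
  refine S.metric_ext p fun u => ?_
  have h1 := hzero v w (J u)
  rw [hJJ, map_smul, smul_eq_mul] at h1
  rw [(mul_eq_zero.1 h1).resolve_left (by linarith), map_zero]; rfl

/-- When ∇S = 0, the extended shape operator varies only through the turning of the normal space on
which it vanishes; the mixed blocks of its derivative come from dN and dψ. -/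
lemma mvfderiv_inner_shapeExt (hc : c * c = 1) (hn : ∀ p v w, S.nablaShape p v w = 0) (a : 𝔼⁴)
    (p : M) (v : TangentSpace (𝓡 2) p) :
    𝐝 (fun q => pseudoInner c (S.shapeExt q a) a) p v =
      2 * S.ε * S.angle a p * S.metric p (S.shape p (S.tangential p a)) (S.shape p v) -
      2 * c * S.height a p * S.metric p (S.shape p (S.tangential p a)) v := by
  have h0 := hasDeriv_apply (S.diff_shapeExt p) (hasDeriv_const a p).1
  have h1 := hasDeriv_inner (c := c) h0.1 (hasDeriv_const a p).1
  rw [h1.2, h0.2, (hasDeriv_const a p).2, map_zero, map_zero, add_zero, add_zero]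
  set B := 𝐝 S.shapeExt p v with hB
  set X := S.tangential p a with hX
  have hsym := S.inner_dshapeExt_symm hc p v
  have hN : ∀ y, pseudoInner c (B y) (S.N p) =
      S.metric p (S.shape p (S.tangential p y)) (S.shape p v) := by
    intro y
    rw [S.hasDeriv_shapeExt_inner p y (S.diff_N p) (fun q => S.inner_shapeExt_N hc q y),
      S.mvfderiv_N hc, map_neg, neg_neg, S.inner_shapeExt hc, tangential_mvfderiv]
  have hψ : ∀ y, pseudoInner c (B y) (S.ψ p) =
      -S.metric p (S.shape p (S.tangential p y)) v := by
    intro y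
    rw [S.hasDeriv_shapeExt_inner p y (S.diff_ψ p) (fun q => S.inner_shapeExt_ψ hc q y),
      S.inner_shapeExt hc, tangential_mvfderiv]
  have hT : pseudoInner c (B (𝐝 S.ψ p X)) (𝐝 S.ψ p X) = 0 := by
    rw [← metric_nablaShape, hn, map_zero]; rfl
  have hdec : a = 𝐝 S.ψ p X + (S.ε * S.angle a p) • S.N p + (c * S.height a p) • S.ψ p :=
    S.decomposition hc p a
  have e1 : ∀ y, pseudoInner c (B y) a = pseudoInner c (B y) (𝐝 S.ψ p X) +
      S.ε * S.angle a p * pseudoInner c (B y) (S.N p) +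
      c * S.height a p * pseudoInner c (B y) (S.ψ p) := by
    intro y
    conv_lhs => rw [hdec]
    rw [map_add, map_add, map_smul, map_smul]; rfl
  rw [e1, hsym a (𝐝 S.ψ p X), e1, hT, hN, hψ, hN, hψ, tangential_mvfderiv]
  ring

/-- A surface with constant `H` and `H₂`, without real principal curvatures, is flat. -/
lemma secondMeanCurvature_eq_of_lt [Nonempty M] (hc : c * c = 1) {h k : ℝ}
    (hH : ∀ p, S.meanCurvature p = h) (hK : ∀ p, S.secondMeanCurvature p = k) (hlt : h ^ 2 < k) :
    S.ε * k + c = 0 := by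
  by_contra hm
  obtain ⟨p⟩ := (inferInstance : Nonempty M)
  have hn := nablaShape_eq_zero hc hH hK hlt
  obtain ⟨X, hX⟩ := exists_ne_zero_tangent p
  set a := 𝐝 S.ψ p X with ha
  have hu : IsSmooth fun q => pseudoInner c (S.shapeExt q a) a :=
    IsSmooth.bilin (pseudoInnerL c)
      (IsSmooth.clm (ContinuousLinearMap.apply ℝ 𝔼⁴ a) S.smooth_shapeExt) contMDiff_const
  have hf := S.smooth_height a
  have hg := S.smooth_angle a
  have hnn := smooth_mul hg hg
  have hnf := smooth_mul hg hf
  -- The bracket in `hw` has differential −2(εk + c) n df. If εk + c ≠ 0, then n df is exact after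
  -- rescaling by m, so dn and df are proportional.
  let m : ℝ := (-2 * (S.ε * k + c))⁻¹
  have hmm : -2 * (S.ε * k + c) * m = 1 :=
    mul_inv_cancel₀ (mul_ne_zero (by norm_num) hm)
  have hnn' : IsSmooth fun q => (2 * h) • (S.angle a q * S.angle a q) :=
    IsSmooth.clm ((2 * h) • ContinuousLinearMap.id ℝ ℝ) hnn
  have hnf' : IsSmooth fun q => (2 * c) • (S.angle a q * S.height a q) :=
    IsSmooth.clm ((2 * c) • ContinuousLinearMap.id ℝ ℝ) hnf
  have hs0 : IsSmooth fun q => pseudoInner c (S.shapeExt q a) a +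
      (2 * h) • (S.angle a q * S.angle a q) := hu.add hnn'
  have hs1 : IsSmooth fun q => pseudoInner c (S.shapeExt q a) a +
      (2 * h) • (S.angle a q * S.angle a q) - (2 * c) • (S.angle a q * S.height a q) :=
    hs0.sub hnf'
  have hw : IsSmooth fun q => m • (pseudoInner c (S.shapeExt q a) a +
      (2 * h) • (S.angle a q * S.angle a q) - (2 * c) • (S.angle a q * S.height a q)) :=
    IsSmooth.clm (m • ContinuousLinearMap.id ℝ ℝ) hs1
  have key := S.wedge_eq_zero hc hw hg hf (fun q v => by
    rw [(hasDeriv_const_smul m (hs1.isDiffAt q)).2, (hasDeriv_sub (hs0.isDiffAt q)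
      (hnf'.isDiffAt q)).2, (hasDeriv_add (hu.isDiffAt q) (hnn'.isDiffAt q)).2,
      (hasDeriv_const_smul _ (hnn.isDiffAt q)).2, (hasDeriv_const_smul _ (hnf.isDiffAt q)).2,
      (hasDeriv_mul (hg.isDiffAt q) (hg.isDiffAt q)).2,
      (hasDeriv_mul (hg.isDiffAt q) (hf.isDiffAt q)).2, mvfderiv_inner_shapeExt hc hn]
    have e1 : S.metric q (S.shape q (S.tangential q a)) v = -𝐝 (S.angle a) q v := by
      rw [S.mvfderiv_angle hc, neg_neg, S.shape_symm hc, S.metric_comm]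
    have e2 : S.metric q (S.shape q (S.tangential q a)) (S.shape q v) =
        -2 * S.ε * h * 𝐝 (S.angle a) q v - k * 𝐝 (S.height a) q v := by
      rw [S.shape_symm hc, shape_shape, hH, hK, map_sub, LinearMap.sub_apply, map_smul, map_smul,
        LinearMap.smul_apply, LinearMap.smul_apply, S.metric_comm q v, ← S.mvfderiv_height,
        S.mvfderiv_angle hc, S.metric_comm q (S.shape q v), smul_eq_mul, smul_eq_mul]
      ring
    rw [e1, e2]
    simp only [smul_eq_mul]
    linear_combination S.angle a q * 𝐝 (S.height a) q v * hmm -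
      4 * m * h * S.angle a q * 𝐝 (S.angle a) q v * S.ε_mul_self) p
  have hTa : S.tangential p a = X := S.tangential_mvfderiv p X
  simp only [S.mvfderiv_height, S.mvfderiv_angle hc, hTa] at key
  have hu0 : ∃ u, S.metric p X u ≠ 0 := by
    by_contra! hcon
    exact hX (S.metric_ext p fun u => by rw [hcon, map_zero]; rfl)
  obtain ⟨u, hu0⟩ := hu0
  -- At p one has df = ⟨X, ·⟩ and dn = −⟨SX, ·⟩, so proportionality makes X an eigenvector of S; κ
  -- is read off on a vector u with ⟨X, u⟩ ≠ 0.
  refine shape_ne_smul (S := S) (p := p) (by rw [hH, hK]; exact hlt) hX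
    (κ := S.metric p X (S.shape p u) / S.metric p X u) ?_
  refine S.metric_ext p fun v => ?_
  have := key v u
  rw [map_smul, LinearMap.smul_apply, smul_eq_mul, S.shape_symm hc, S.metric_comm,
    div_mul_eq_mul_div, eq_div_iff hu0]
  linarith

lemma IsL₁TwoType.principal_const [ConnectedSpace M] (hc : c * c = 1) (hS : S.IsL₁TwoType)
    (h₁ : S.HasConstantMeanCurvature) (h₂ : S.HasConstantSecondMeanCurvature) :
    S.HasConstantPrincipalCurvature := by
  obtain ⟨h, hH⟩ := h₁
  obtain ⟨k, hK⟩ := h₂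
  have hεε := S.ε_mul_self
  rcases le_or_gt k (h ^ 2) with hle | hlt
  · refine ⟨S.ε * h + √(h ^ 2 - k), fun p => hasEigenvalue_of_root ?_⟩
    rw [hH, hK]
    linear_combination Real.sq_sqrt (sub_nonneg.2 hle) - h ^ 2 * hεε
  exfalso
  obtain ⟨a, l₁, l₂, hne, E1, E2, E3⟩ := hS.equations hc
  obtain ⟨p⟩ := (inferInstance : Nonempty M)
  have hflat := secondMeanCurvature_eq_of_lt hc hH hK hlt
  -- If l ≠ 0, E1 makes f constant, so εnS = cfI; as S is not a multiple of I, n = 0 and then f = 0.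
  have hL : l₁ * l₂ * S.angle a p = 0 ∧ l₁ * l₂ * S.height a p = 0 := by
    by_cases hl : l₁ * l₂ = 0
    · rw [hl, zero_mul, zero_mul]; exact ⟨rfl, rfl⟩
    have hd : ∀ q v, 𝐝 (S.height a) q v = 0 := by
      intro q v
      have := E1 q v
      rw [mvfderiv_of_eq_const hH, mvfderiv_of_eq_const hK, mul_zero, mul_zero, add_zero] at this
      exact (mul_eq_zero.1 this.symm).resolve_left hl
    have hg : S.gradVec (S.height a) = fun _ => 0 := by
      ext1 q
      have : S.gradient (S.height a) q = 0 := S.gradient_unique fun w => by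
        rw [hd, map_zero]; rfl
      rw [gradVec, this, map_zero]
    have hh : ∀ v, S.hessian (S.height a) p v = 0 := by
      intro v
      rw [hessian_apply, hg, (hasDeriv_const _ p).2, map_zero]
    obtain ⟨v, hv⟩ := exists_ne_zero_tangent p
    have hv' := hh v
    rw [S.hessian_height hc, sub_eq_zero] at hv'
    have hε0 : S.ε ≠ 0 := fun h0 => by rw [h0] at hεε; norm_num at hεε
    have hc0 : c ≠ 0 := fun h0 => by rw [h0] at hc; norm_num at hc
    by_cases hn : S.angle a p = 0
    · rw [hn, mul_zero, zero_smul] at hv'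
      have : c * S.height a p = 0 := (smul_eq_zero.1 hv'.symm).resolve_right hv
      rw [hn, (mul_eq_zero.1 this).resolve_left hc0, mul_zero]; exact ⟨rfl, rfl⟩
    · refine absurd ?_ (shape_ne_smul (S := S) (p := p) (by rw [hH, hK]; exact hlt) hv
        (κ := (S.ε * S.angle a p)⁻¹ * (c * S.height a p)))
      rw [mul_smul, ← hv', smul_smul, inv_mul_cancel₀ (mul_ne_zero hε0 hn), one_smul]
  have e2 := E2 p
  have e3 := E3 p
  rw [hL.1, hH, hK, L₁_of_eq_const hK] at e2
  rw [hL.2, hH, hK, L₁_of_eq_const hH] at e3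
  have hk : k = -c * S.ε := by linear_combination S.ε * hflat - k * hεε
  -- The other sign would give k = −1, contrary to k > h² ≥ 0.
  have hcε : c * S.ε = -1 := by
    have h2 : (c * S.ε) * (c * S.ε) = 1 := by linear_combination hc * S.ε ^ 2 + hεε
    rcases mul_self_eq_one_iff.1 h2 with h3 | h3
    · nlinarith [sq_nonneg h]
    · exact h3
  have hk1 : k = 1 := by linarith
  rw [hk1] at e2 e3 hlt
  have hsum : l₁ + l₂ = 0 := by linear_combination (-1 / 2 : ℝ) * e2 + 2 * h * hcε
  have hl2 : l₂ = -l₁ := by linarith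
  -- Here l₁l₂ = −l₁² ≤ 0, whereas h² < k = 1 makes 4 − 4h² positive.
  have e4 : l₁ * l₂ = 4 - 4 * h ^ 2 := by
    linear_combination -c * e3 - l₁ * l₂ * hc + 2 * c * S.ε * h * hsum - 4 * hcε -
      4 * h ^ 2 * hc
  rw [hl2] at e4
  nlinarith [sq_nonneg l₁]

end OrientedSurface

end

theorem theoremA (c : ℝ) (hc : c = 1 ∨ c = -1) {M : Type*} [TopologicalSpace M]
    [ChartedSpace (EuclideanSpace ℝ (Fin 2)) M] [IsManifold (𝓡 2) ∞ M] [ConnectedSpace M]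
    (S : OrientedSurface c M) (hS : S.IsL₁TwoType) :
    List.TFAE [S.HasConstantPrincipalCurvature, S.HasConstantMeanCurvature,
      S.HasConstantSecondMeanCurvature] := by
  have hcc : c * c = 1 := by rcases hc with rfl | rfl <;> norm_num
  tfae_have 1 → 2 := hS.meanCurvature_const_of_principal hcc
  tfae_have 2 → 3 := hS.secondMeanCurvature_const hcc
  tfae_have 3 → 2 := hS.meanCurvature_const_of_second hcc
  tfae_have 2 → 1 := fun h => hS.principal_const hcc h (hS.secondMeanCurvature_const hcc h)
  tfae_finish
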